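/- Let $\mathbb{H}(\mathbb{C})$ be the algebra of complex quaternions, with $\mathbb C$-basis $1,I,J,K$, where $I^2=J^2=K^2=-1$, $IJ=-JI=K$, $JK=-KJ=I$, $KI=-IK=J$. Put $$e_1=\tfrac12(1+iI),\quad e_2=\tfrac12(1-iI),\quad e_3=\tfrac12(iJ-K),\quad e_4=\tfrac12(iJ+K),$$ a basis of $\mathbb{H}(\mathbb{C})$, and $\bigl\|\sum_k a_ke_k\bigr\|=\bigl(\sum_k|a_k|^2\bigr)^{1/2}$. Let $\mathcal I_1=\{\lambda_2e_2+\lambda_4e_4:\lambda_2,\lambda_4\in\mathbb C\}$ (a right ideal) and $\widehat{\mathcal I}_1=\{\lambda_2e_2+\lambda_3e_3:\lambda_2,\lambda_3\in\mathbb C\}$ (a left ideal). Let $f_1,f_2:\mathbb{H}(\mathbb{C})\to\mathbb C$ be the linear functionals with $f_1(e_1)=f_1(e_3)=1$, $f_1(e_2)=f_1(e_4)=0$ and $f_2(e_2)=f_2(e_4)=1$, $f_2(e_1)=f_2(e_3)=0$. Let $a_1,a_2,b_1,b_2\in\mathbb C$ be such that $i_1=1$, $i_2=a_1e_1+a_2e_2$,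 $i_3=b_1e_1+b_2e_2$ are linearly independent over $\mathbb R$; let $E_3=\{xi_1+yi_2+zi_3:x,y,z\in\mathbb R\}$, and suppose that $f_1(E_3)=f_2(E_3)=\mathbb C$. Let $\Omega\subset\mathbb R^3$ be a domain (a non-empty connected open set), $\Omega_\zeta=\{xi_1+yi_2+zi_3:(x,y,z)\in\Omega\}$, $\xi_2=x+ya_2+zb_2$ and $D_2=f_2(\Omega_\zeta)\subset\mathbb C$. Suppose that $\Omega$ is convex in the direction of the line $$L_2=\{(x,y,z)\in\mathbb R^3: x+y\,\mathrm{Re}\,a_2+z\,\mathrm{Re}\,b_2=0,\ \ y\,\mathrm{Im}\,a_2+z\,\mathrm{Im}\,b_2=0\},$$ that is, $\Omega$ contains every segment parallel to $L_2$ that joins two points of $\Omega$. A continuous map $\Phi:\Omega_\zeta\to\mathbb{H}(\mathbb{C})$ is called right-$G$-monogenic (respectively left-$G$-monogenic) if for every $\zeta\in\Omega_\zeta$ there is an element $\Phi'(\zeta)\in\mathbb{H}(\mathbb{C})$ such that for all $h\in E_3$ $$\lim_{\varepsilon\to0+}\frac{\Phi(\zeta+\varepsilon h)-\Phi(\zeta)}{\varepsilon}=h\,\Phi'(\zeta)\qquad\bigl(\text{respectively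 } =\Phi'(\zeta)\,h\bigr).$$ Then for every right-$G$-monogenic map $\Phi:\Omega_\zeta\to\mathcal I_1$ there are functions $F_{12},F_{14}$, analytic on $D_2$, such that $$\Phi(\zeta)=F_{12}(\xi_2)e_2+F_{14}(\xi_2)e_4\qquad\text{for all }\zeta=xi_1+yi_2+zi_3\in\Omega_\zeta,$$ and for every left-$G$-monogenic map $\widehat\Phi:\Omega_\zeta\to\widehat{\mathcal I}_1$ there are functions $F_{11},F_{13}$, analytic on $D_2$, such that $$\widehat\Phi(\zeta)=F_{11}(\xi_2)e_2+F_{13}(\xi_2)e_3\qquad\text{for all }\zeta=xi_1+yi_2+zi_3\in\Omega_\zeta.$$ -/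

import Mathlib

open Filter Topology
open scoped Quaternion

noncomputable section

namespace ComplexQuaternion

/-- The algebra of complex quaternions, with `ℂ`-basis `1, I, J, K` and `I² = J² = K² = -1`,
`IJ = -JI = K`. -/
abbrev HC : Type := ℍ[ℂ, -1, -1]

/-- `e₁ = (1 + iI) / 2`. -/
def e₁ : HC := ⟨1 / 2, Complex.I / 2, 0, 0⟩
/-- `e₂ = (1 - iI) / 2`. -/
def e₂ : HC := ⟨1 / 2, -Complex.I / 2, 0, 0⟩
/-- `e₃ = (iJ - K) / 2`. -/
def e₃ : HC := ⟨0, 0, Complex.I / 2, -1 / 2⟩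
/-- `e₄ = (iJ + K) / 2`. -/
def e₄ : HC := ⟨0, 0, Complex.I / 2, 1 / 2⟩

theorem combination_eq (l₁ l₂ l₃ l₄ : ℂ) :
    l₁ • e₁ + l₂ • e₂ + l₃ • e₃ + l₄ • e₄ =
      (⟨(l₁ + l₂) / 2, Complex.I * (l₁ - l₂) / 2,
        Complex.I * (l₃ + l₄) / 2, (l₄ - l₃) / 2⟩ : HC) := by
  ext <;> simp [e₁, e₂, e₃, e₄] <;> ring

/-- The coordinates of a complex quaternion with respect to `e₁, e₂, e₃, e₄`. -/
def coordEquiv : HC ≃ₗ[ℂ] (Fin 4 → ℂ) where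
  toFun a := ![a.re - Complex.I * a.imI, a.re + Complex.I * a.imI,
    -Complex.I * a.imJ - a.imK, -Complex.I * a.imJ + a.imK]
  invFun l := l 0 • e₁ + l 1 • e₂ + l 2 • e₃ + l 3 • e₄
  map_add' a b := by
    ext k; fin_cases k <;> simp <;> ring
  map_smul' c a := by
    ext k; fin_cases k <;> simp <;> ring
  left_inv a := by
    dsimp only
    rw [combination_eq]
    ext <;> simp <;> ring_nf <;> simp
  right_inv l := by
    dsimp only
    rw [combination_eq]
    ext k
    fin_cases k <;> simp <;> ring_nf <;> simp <;> ring

/-- The basis `e₁, e₂, e₃, e₄` of the algebra of complex quaternions. -/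
def eBasis : Module.Basis (Fin 4) ℂ HC := Module.Basis.ofEquivFun coordEquiv

theorem eBasis_eq : (eBasis : Fin 4 → HC) = ![e₁, e₂, e₃, e₄] := by
  funext k
  fin_cases k <;> simp [eBasis, coordEquiv]

/-- The norm `‖a‖ = (|a₁|² + |a₂|² + |a₃|² + |a₄|²)^(1/2)` for `a = ∑ aₖ eₖ`. -/
instance instNormedAddCommGroupHC : NormedAddCommGroup HC :=
  NormedAddCommGroup.induced HC (EuclideanSpace ℂ (Fin 4))
    ((WithLp.linearEquiv 2 ℂ (Fin 4 → ℂ)).symm.toLinearMap ∘ₗ coordEquiv.toLinearMap)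
    ((WithLp.linearEquiv 2 ℂ (Fin 4 → ℂ)).symm.injective.comp coordEquiv.injective)

theorem norm_eq (a : HC) : ‖a‖ = Real.sqrt (∑ k, ‖eBasis.repr a k‖ ^ 2) :=
  EuclideanSpace.norm_eq (WithLp.toLp 2 (coordEquiv a))

/-- The right ideal `I₁ = {l₂ e₂ + l₄ e₄}`. -/
def idealI₁ : Submodule (HC)ᵐᵒᵖ HC where
  carrier := {a | ∃ l₂ l₄ : ℂ, a = l₂ • e₂ + l₄ • e₄}
  zero_mem' := ⟨0, 0, by simp⟩
  add_mem' := by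
    rintro _ _ ⟨l₂, l₄, rfl⟩ ⟨m₂, m₄, rfl⟩
    exact ⟨l₂ + m₂, l₄ + m₄, by module⟩
  smul_mem' := by
    rintro y _ ⟨l₂, l₄, rfl⟩
    obtain ⟨y, rfl⟩ := MulOpposite.op_surjective y
    obtain ⟨m, rfl⟩ := coordEquiv.symm.surjective y
    refine ⟨l₂ * m 1 + l₄ * m 2, l₂ * m 3 + l₄ * m 0, ?_⟩
    rw [op_smul_eq_mul]
    change _ * (m 0 • e₁ + m 1 • e₂ + m 2 • e₃ + m 3 • e₄) = _
    ext <;> simp [e₁, e₂, e₃, e₄] <;> ring_nf <;> simp <;> ring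

/-- The left ideal `Î₁ = {l₂ e₂ + l₃ e₃}`. -/
def idealIhat₁ : Submodule HC HC where
  carrier := {a | ∃ l₂ l₃ : ℂ, a = l₂ • e₂ + l₃ • e₃}
  zero_mem' := ⟨0, 0, by simp⟩
  add_mem' := by
    rintro _ _ ⟨l₂, l₃, rfl⟩ ⟨m₂, m₃, rfl⟩
    exact ⟨l₂ + m₂, l₃ + m₃, by module⟩
  smul_mem' := by
    rintro y _ ⟨l₂, l₃, rfl⟩
    obtain ⟨m, rfl⟩ := coordEquiv.symm.surjective y
    refine ⟨m 1 * l₂ + m 3 * l₃, m 2 * l₂ + m 0 * l₃, ?_⟩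
    rw [smul_eq_mul]
    change (m 0 • e₁ + m 1 • e₂ + m 2 • e₃ + m 3 • e₄) * _ = _
    ext <;> simp [e₁, e₂, e₃, e₄] <;> ring_nf <;> simp <;> ring

/-- The linear functional with `f₁ e₁ = f₁ e₃ = 1` and `f₁ e₂ = f₁ e₄ = 0`. -/
def f₁ : HC →ₗ[ℂ] ℂ := eBasis.constr ℂ ![1, 0, 1, 0]

/-- The linear functional with `f₂ e₂ = f₂ e₄ = 1` and `f₂ e₁ = f₂ e₃ = 0`. -/
def f₂ : HC →ₗ[ℂ] ℂ := eBasis.constr ℂ ![0, 1, 0, 1]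

/-- The triple `i₁ = 1`, `i₂ = a₁ e₁ + a₂ e₂`, `i₃ = b₁ e₁ + b₂ e₂`. -/
def triple (a₁ a₂ b₁ b₂ : ℂ) : Fin 3 → HC :=
  ![1, a₁ • e₁ + a₂ • e₂, b₁ • e₁ + b₂ • e₂]

/-- The real linear span `E₃` of `i₁, i₂, i₃`. -/
def E₃ (a₁ a₂ b₁ b₂ : ℂ) : Submodule ℝ HC :=
  Submodule.span ℝ (Set.range (triple a₁ a₂ b₁ b₂))

/-- `ζ = x i₁ + y i₂ + z i₃` for `p = (x, y, z)`. -/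
def zeta (a₁ a₂ b₁ b₂ : ℂ) (p : EuclideanSpace ℝ (Fin 3)) : HC :=
  ∑ k, p k • triple a₁ a₂ b₁ b₂ k

/-- The subset `Ω_ζ` of `E₃` corresponding to `Ω ⊆ ℝ³`. -/
def Omegaζ (a₁ a₂ b₁ b₂ : ℂ) (Ω : Set (EuclideanSpace ℝ (Fin 3))) : Set HC :=
  zeta a₁ a₂ b₁ b₂ '' Ω

/-- `ξ₂ = x + y a₂ + z b₂`. -/
def xi₂ (a₂ b₂ : ℂ) (p : EuclideanSpace ℝ (Fin 3)) : ℂ :=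
  (p 0 : ℂ) + (p 1 : ℂ) * a₂ + (p 2 : ℂ) * b₂

/-- The line `L₂` in `ℝ³`, which passes through the origin. -/
def L₂ (a₂ b₂ : ℂ) : Submodule ℝ (EuclideanSpace ℝ (Fin 3)) where
  carrier := {p | p 0 + p 1 * a₂.re + p 2 * b₂.re = 0 ∧ p 1 * a₂.im + p 2 * b₂.im = 0}
  zero_mem' := by simp
  add_mem' := by
    rintro p q ⟨hp, hp'⟩ ⟨hq, hq'⟩
    constructor <;> simp only [PiLp.add_apply] <;> linarith
  smul_mem' := by
    rintro c p ⟨hp, hp'⟩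
    constructor
    · simp only [PiLp.smul_apply, smul_eq_mul]
      linear_combination c * hp
    · simp only [PiLp.smul_apply, smul_eq_mul]
      linear_combination c * hp'

/-- `Ω` is convex in the direction of the line `L` through the origin: it contains every segment
parallel to `L` that joins two points of `Ω`. -/
def ConvexInDirection (L : Submodule ℝ (EuclideanSpace ℝ (Fin 3)))
    (Ω : Set (EuclideanSpace ℝ (Fin 3))) : Prop :=
  ∀ p ∈ Ω, ∀ q ∈ Ω, q - p ∈ L → segment ℝ p q ⊆ Ω

/-- `Φ` is right-`G`-monogenic on the domain `U` of the real subspace `E`: it is continuous on `U`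
and at each point `ζ` of `U` it has a right Gateaux derivative `Φ'`, that is,
`(Φ (ζ + ε h) - Φ ζ) / ε → h Φ'` as `ε → 0+` for all `h ∈ E`. -/
def IsRightGMonogenic (E : Submodule ℝ HC) (U : Set HC) (Φ : HC → HC) : Prop :=
  ContinuousOn Φ U ∧ ∀ ζ ∈ U, ∃ Φ' : HC, ∀ h ∈ E,
    Tendsto (fun ε : ℝ => ε⁻¹ • (Φ (ζ + ε • h) - Φ ζ)) (𝓝[>] 0) (𝓝 (h * Φ'))

/-- `Φ` is left-`G`-monogenic on the domain `U` of the real subspace `E`: it is continuous on `U`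
and at each point `ζ` of `U` it has a left Gateaux derivative `Φ'`, that is,
`(Φ (ζ + ε h) - Φ ζ) / ε → Φ' h` as `ε → 0+` for all `h ∈ E`. -/
def IsLeftGMonogenic (E : Submodule ℝ HC) (U : Set HC) (Φ : HC → HC) : Prop :=
  ContinuousOn Φ U ∧ ∀ ζ ∈ U, ∃ Φ' : HC, ∀ h ∈ E,
    Tendsto (fun ε : ℝ => ε⁻¹ • (Φ (ζ + ε • h) - Φ ζ)) (𝓝[>] 0) (𝓝 (Φ' * h))

end ComplexQuaternion

end

/-! Write `ζ = ξ₁ e₁ + ξ₂ e₂`. Since `e₂ e₂ = e₂`, `e₂ e₄ = e₄` and `e₁ e₂ = e₁ e₄ = 0`, the `e₂`-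
and `e₄`-coordinates of `ζ a` are those of `a` times `ξ₂`; for `a ζ` the same holds with `e₃` in
place of `e₄`. Hence each relevant coordinate `u` of `Φ`, read on `Ω`, has directional derivatives
`ξ₂(h) c`. They vanish along `L₂`, so by convexity in that direction `u` is constant on the fibres
of `ξ₂`, and `u = F ∘ ξ₂` with `F` continuous on `D₂`.

Surjectivity of `ξ₂` turns the hypothesis into `∂F/∂x = c`, `∂F/∂y = i c` at every point. Nothing is
known about total differentiability of `F` or continuity of `c`, so holomorphy is exactly the
Looman–Menchoff theorem, which is proved first (`differentiableOn_of_continuous_of_cauchyRiemann`).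

For it, let `E` be the set of points where `F` is not analytic. If `E` is nonempty, Baire's theorem
gives a disc meeting `E` in which the horizontal and vertical difference quotients of `F` at points
of `E` are bounded by one `N`. With `K` the part of `E` in a rectangle, the boundary integral over a
cell `Q` meeting `K` is at most a constant times `N |Q \ K|` (`norm_rectIntegral_le`), and it is
zero if `Q` misses `K`. Summing over a fine grid bounds the whole integral by the area of a thin
neighbourhood of `K` minus `K`, which tends to zero. Morera's theorem then makes `F` analytic on the
disc, a contradiction. -/

/-! ### Increments compared with integrals over a closed set -/

open MeasureTheory Set in
theorem ae_mem_imp_uniqueDiffWithinAt (S : Set ℝ) :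
    ∀ᵐ x, x ∈ S → UniqueDiffWithinAt ℝ S x := by
  -- All but countably many points of `S` are limits of points of `S` from the right, and a
  -- derivative within `S` is unique at such points.
  have h : {x | x ∈ S ∧ 𝓝[S ∩ Ioi x] x = ⊥}.Countable :=
    countable_setOfPred_isolated_right_within
  filter_upwards [h.ae_notMem volume] with x hx hxS
  rw [uniqueDiffWithinAt_iff_accPt, accPt_principal_iff_nhdsWithin]
  have hne : (𝓝[S ∩ Ioi x] x).NeBot := ⟨fun h0 => hx ⟨hxS, h0⟩⟩
  exact hne.mono (nhdsWithin_mono x fun y hy => ⟨hy.1, ne_of_gt hy.2⟩)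

-- Only differences based at points of `S` are controlled, so `f` is replaced by a Lipschitz
-- extension `g` of its restriction to `S`. The fundamental theorem of calculus holds for `g`, and
-- `g' = c` almost everywhere on `S`. Off `S`, `|g'| ≤ N` costs `N`; the gaps between `f` and `g` at
-- `a` and `b` cost `2N` times the distances to the extreme points of `S`. Together this gives `3N`.
open MeasureTheory Set in
theorem abs_sub_sub_setIntegral_le {f c : ℝ → ℝ} {a b N : ℝ} {S : Set ℝ} (hab : a ≤ b)
    (hN : 0 ≤ N) (hSc : IsClosed S) (hS : S ⊆ Icc a b) (hne : S.Nonempty)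
    (hL : ∀ s ∈ S, ∀ x ∈ Icc a b, |f x - f s| ≤ N * |x - s|)
    (hd : ∀ s ∈ S, HasDerivAt f (c s) s) :
    |f b - f a - ∫ x in S, c x| ≤ 3 * N * volume.real (Icc a b \ S) := by
  have hSK : IsCompact S := isCompact_Icc.of_isClosed_subset hSc hS
  obtain ⟨g, hg, hfg⟩ : ∃ g : ℝ → ℝ, LipschitzWith N.toNNReal g ∧ EqOn f g S := by
    refine LipschitzOnWith.extend_real (LipschitzOnWith.of_dist_le_mul fun x hx y hy => ?_)
    rw [Real.dist_eq, Real.dist_eq, Real.coe_toNNReal _ hN]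
    exact hL y hy x (hS hx)
  have hgl : ∀ x y, |g x - g y| ≤ N * |x - y| := fun x y => by
    have := hg.dist_le_mul x y
    rwa [Real.dist_eq, Real.dist_eq, Real.coe_toNNReal _ hN] at this
  have hgd : ∀ x, ‖deriv g x‖ ≤ N := fun x => by
    have := norm_deriv_le_of_lipschitz (x₀ := x) hg
    rwa [Real.coe_toNNReal _ hN] at this
  obtain ⟨s, hs⟩ := hSK.exists_isLeast hne
  obtain ⟨t, ht⟩ := hSK.exists_isGreatest hne
  have hsI := hS hs.1
  have htI := hS ht.1
  have hst : s ≤ t := hs.2 ht.1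
  have hfin : volume (Icc a b \ S) ≠ ⊤ :=
    ((measure_mono sdiff_subset).trans_lt measure_Icc_lt_top).ne
  have hends : (s - a) + (b - t) ≤ volume.real (Icc a b \ S) := by
    have h1 : volume.real (Ico a s ∪ Ioc t b) = (s - a) + (b - t) := by
      rw [measureReal_union (h₁ := measure_Ico_lt_top.ne) (h₂ := measure_Ioc_lt_top.ne)]
      · rw [Real.volume_real_Ico_of_le hsI.1, Real.volume_real_Ioc_of_le htI.2]
      · exact disjoint_left.2 fun x hx hx' => by linarith [hx.2, hx'.1]
      · exact measurableSet_Ioc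
    rw [← h1]
    refine measureReal_mono ?_ hfin
    rintro x (hx | hx)
    · exact ⟨⟨hx.1, by linarith [hx.2, hsI.2]⟩, fun h => not_le.2 hx.2 (hs.2 h)⟩
    · exact ⟨⟨by linarith [hx.1, htI.1], hx.2⟩, fun h => not_le.2 hx.1 (ht.2 h)⟩
  have hint : IntegrableOn (deriv g) (Icc a b) :=
    Measure.integrableOn_of_bounded (M := N) measure_Icc_lt_top.ne
      (measurable_deriv g).aestronglyMeasurable (ae_of_all _ hgd)
  have hftc : ∫ x in Icc a b, deriv g x = g b - g a := by
    rw [integral_Icc_eq_integral_Ioc, ← intervalIntegral.integral_of_le hab]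
    exact (hg.lipschitzOnWith).absolutelyContinuousOnInterval.integral_deriv_eq_sub
  have hsplit : ∫ x in Icc a b, deriv g x
      = (∫ x in S, deriv g x) + ∫ x in Icc a b \ S, deriv g x := by
    rw [setIntegral_sdiff hSc.measurableSet hint hS]
    ring
  have hcS : ∫ x in S, deriv g x = ∫ x in S, c x := by
    refine setIntegral_congr_ae hSc.measurableSet ?_
    filter_upwards [ae_mem_imp_uniqueDiffWithinAt S, hg.ae_differentiableAt_of_real]
      with x hx hgx hxS
    exact (hx hxS).eq_deriv _ hgx.hasDerivAt.hasDerivWithinAt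
      ((hd x hxS).hasDerivWithinAt.congr (fun y hy => (hfg hy).symm) (hfg hxS).symm)
  have hrest : |∫ x in Icc a b \ S, deriv g x| ≤ N * volume.real (Icc a b \ S) :=
    norm_setIntegral_le_of_norm_le_const hfin.lt_top fun x _ => hgd x
  have e1 := hL t ht.1 b ⟨hab, le_rfl⟩
  have e2 := hL s hs.1 a ⟨le_rfl, hab⟩
  have e3 := hgl b t
  have e4 := hgl a s
  rw [← hfg ht.1] at e3
  rw [← hfg hs.1] at e4
  rw [abs_of_nonneg (by linarith [htI.2] : 0 ≤ b - t)] at e1 e3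
  rw [abs_sub_comm a s, abs_of_nonneg (by linarith [hsI.1] : 0 ≤ s - a)] at e2 e4
  have e5 := mul_le_mul_of_nonneg_left hends hN
  rw [abs_le] at e1 e2 e3 e4 hrest ⊢
  constructor <;> linarith

open MeasureTheory Set in
theorem norm_sub_sub_setIntegral_le {f c : ℝ → ℂ} {a b N : ℝ} {S : Set ℝ} (hab : a ≤ b)
    (hN : 0 ≤ N) (hSc : IsClosed S) (hS : S ⊆ Icc a b) (hne : S.Nonempty)
    (hL : ∀ s ∈ S, ∀ x ∈ Icc a b, ‖f x - f s‖ ≤ N * |x - s|)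
    (hd : ∀ s ∈ S, HasDerivAt f (c s) s) (hc : IntegrableOn c S) :
    ‖f b - f a - ∫ x in S, c x‖ ≤ 6 * N * volume.real (Icc a b \ S) := by
  have h1 := abs_sub_sub_setIntegral_le (f := fun x => (f x).re) (c := fun x => (c x).re) hab hN hSc
    hS hne (fun s hs x hx => by
      rw [← Complex.sub_re]; exact (Complex.abs_re_le_norm _).trans (hL s hs x hx))
    (fun s hs => Complex.reCLM.hasFDerivAt.comp_hasDerivAt s (hd s hs))
  have h2 := abs_sub_sub_setIntegral_le (f := fun x => (f x).im) (c := fun x => (c x).im) hab hN hSc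
    hS hne (fun s hs x hx => by
      rw [← Complex.sub_im]; exact (Complex.abs_im_le_norm _).trans (hL s hs x hx))
    (fun s hs => Complex.imCLM.hasFDerivAt.comp_hasDerivAt s (hd s hs))
  have h3 : ∫ x in S, (c x).re = (∫ x in S, c x).re := Complex.reCLM.integral_comp_comm hc
  have h4 : ∫ x in S, (c x).im = (∫ x in S, c x).im := Complex.imCLM.integral_comp_comm hc
  rw [h3] at h1
  rw [h4] at h2
  refine (Complex.norm_le_abs_re_add_abs_im _).trans ?_
  simp only [Complex.sub_re, Complex.sub_im]
  linarith

-- Integrates the one-dimensional estimate over the slices of `K`. The error is measured in the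
-- larger box `[a', b'] × [c', d']` because only its aspect ratio is controlled; `[a, b] × [c, d]`
-- will be the bounding box of `K`, which may be very thin.
open MeasureTheory Set in
theorem norm_integral_sub_sub_setIntegral_le {G h : ℝ × ℝ → ℂ} {a b c d a' b' c' d' N ρ : ℝ}
    {K : Set (ℝ × ℝ)} (hG : Continuous G) (hh : Measurable h) (hN : 0 ≤ N) (hρ : 0 ≤ ρ)
    (hab : a ≤ b) (hcd : c ≤ d) (ha : a' ≤ a) (hb : b ≤ b') (hc : c' ≤ c) (hd : d ≤ d')
    (hasp : b' - a' ≤ ρ * (d' - c'))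
    (hK : IsCompact K) (hKI : K ⊆ Icc a b ×ˢ Icc c d)
    (hbot : ∃ s, (s, c) ∈ K) (htop : ∃ s, (s, d) ∈ K)
    (hL₁ : ∀ p ∈ K, ∀ s ∈ Icc a b, ‖G (s, p.2) - G p‖ ≤ N * |s - p.1|)
    (hL₂ : ∀ p ∈ K, ∀ t ∈ Icc c d, ‖G (p.1, t) - G p‖ ≤ N * |t - p.2|)
    (hder : ∀ p ∈ K, HasDerivAt (fun t => G (p.1, t)) (h p) p.2)
    (hbd : ∀ p ∈ K, ‖h p‖ ≤ N) :
    ‖(∫ s in a..b, (G (s, d) - G (s, c))) - ∫ p in K, h p‖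
      ≤ N * (3 * ρ + 6) * volume.real ((Icc a' b' ×ˢ Icc c' d') \ K) := by
  have hKm := hK.measurableSet
  have hKint : IntegrableOn h K :=
    Measure.integrableOn_of_bounded (M := N) hK.measure_lt_top.ne hh.aestronglyMeasurable
      ((ae_restrict_iff' hKm).2 (ae_of_all _ hbd))
  have hind : Integrable (K.indicator h) (volume.prod volume) := by
    rw [← Measure.volume_eq_prod]
    exact (integrable_indicator_iff hKm).2 hKint
  have hslice (s : ℝ) : IsClosed (Prod.mk s ⁻¹' K) := hK.isClosed.preimage (by fun_prop)
  have hsliceI (s : ℝ) : Prod.mk s ⁻¹' K ⊆ Icc c d := fun t ht => (hKI ht).2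
  have hFub : ∫ p in K, h p = ∫ s in Icc a b, ∫ t in Prod.mk s ⁻¹' K, h (s, t) := by
    calc ∫ p in K, h p = ∫ p in Icc a b ×ˢ Icc c d, K.indicator h p := by
          rw [setIntegral_indicator hKm, inter_eq_right.2 hKI]
      _ = ∫ s in Icc a b, ∫ t in Icc c d, K.indicator h (s, t) := by
          rw [Measure.volume_eq_prod]
          exact setIntegral_prod _ hind.integrableOn
      _ = _ := by
          refine integral_congr_ae (ae_of_all _ fun s => ?_)
          change ∫ t in Icc c d, (Prod.mk s ⁻¹' K).indicator (fun t => h (s, t)) t = _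
          rw [setIntegral_indicator (hslice s).measurableSet, inter_eq_right.2 (hsliceI s)]
  have hFubint : IntegrableOn (fun s => ∫ t in Prod.mk s ⁻¹' K, h (s, t)) (Icc a b) := by
    have h1 := hind.integral_prod_left
    refine (h1.congr (ae_of_all _ fun s => ?_)).integrableOn
    change ∫ t, (Prod.mk s ⁻¹' K).indicator (fun t => h (s, t)) t = _
    rw [integral_indicator (hslice s).measurableSet]
  have hcompl : IntegrableOn (Kᶜ.indicator fun _ => (1 : ℝ)) (Icc a' b' ×ˢ Icc c' d')
      (volume.prod volume) := by
    rw [← Measure.volume_eq_prod]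
    refine IntegrableOn.indicator (integrableOn_const ?_) hKm.compl
    exact (isCompact_Icc.prod isCompact_Icc).measure_lt_top.ne
  have hsl (s : ℝ) : ∫ t in Icc c' d', Kᶜ.indicator (fun _ => (1 : ℝ)) (s, t)
      = volume.real (Icc c' d' \ Prod.mk s ⁻¹' K) := by
    change ∫ t in Icc c' d', (Prod.mk s ⁻¹' K)ᶜ.indicator (fun _ => (1 : ℝ)) t = _
    rw [setIntegral_indicator (hslice s).measurableSet.compl, setIntegral_const]
    simp [sdiff_eq]
  have hvol : volume.real ((Icc a' b' ×ˢ Icc c' d') \ K)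
      = ∫ s in Icc a' b', volume.real (Icc c' d' \ Prod.mk s ⁻¹' K) := by
    calc volume.real ((Icc a' b' ×ˢ Icc c' d') \ K)
        = ∫ p in Icc a' b' ×ˢ Icc c' d', Kᶜ.indicator (fun _ => (1 : ℝ)) p := by
          rw [setIntegral_indicator hKm.compl, setIntegral_const]
          simp [sdiff_eq]
      _ = ∫ s in Icc a' b', ∫ t in Icc c' d', Kᶜ.indicator (fun _ => (1 : ℝ)) (s, t) := by
          rw [Measure.volume_eq_prod]
          exact setIntegral_prod _ hcompl
      _ = _ := integral_congr_ae (ae_of_all _ fun s => hsl s)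
  have hvolint : IntegrableOn (fun s => volume.real (Icc c' d' \ Prod.mk s ⁻¹' K))
      (Icc a' b') := by
    rw [IntegrableOn, ← Measure.prod_restrict] at hcompl
    exact hcompl.integral_prod_left.congr (ae_of_all _ fun s => hsl s)
  have hsub : Icc a b ⊆ Icc a' b' := Icc_subset_Icc ha hb
  have hpt : ∀ s ∈ Icc a b, ‖(G (s, d) - G (s, c)) - ∫ t in Prod.mk s ⁻¹' K, h (s, t)‖
      ≤ N * (3 * ρ + 6) * volume.real (Icc c' d' \ Prod.mk s ⁻¹' K) := by
    intro s hs
    rcases (Prod.mk s ⁻¹' K).eq_empty_or_nonempty with he | hne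
    -- A slice missing `K` loses its full length `d' - c'`. The increment is bounded along the path
    -- `(s, d)`, `(s₂, d)`, `(s₂, c)`, `(s₁, c)`, `(s, c)`, each leg of which has an end in `K`:
    -- three horizontal legs give `3ρ`, the vertical one gives `1`.
    · obtain ⟨s₁, h₁⟩ := hbot
      obtain ⟨s₂, h₂⟩ := htop
      rw [he, setIntegral_empty, sub_zero, sdiff_empty,
        Real.volume_real_Icc_of_le (by linarith)]
      have hs₁ := (hKI h₁).1
      have hs₂ := (hKI h₂).1
      have key : ∀ u ∈ Icc a b, ∀ v ∈ Icc a b, |u - v| ≤ b' - a' := fun u hu v hv =>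
        abs_le.2 ⟨by linarith [hu.1, hv.2], by linarith [hu.2, hv.1]⟩
      have e1 := (hL₁ _ h₂ s hs).trans (mul_le_mul_of_nonneg_left (key s hs s₂ hs₂) hN)
      have e2 := hL₂ _ h₂ c ⟨le_rfl, hcd⟩
      have e3 := (hL₁ _ h₁ s₂ hs₂).trans (mul_le_mul_of_nonneg_left (key s₂ hs₂ s₁ hs₁) hN)
      have e4 := (hL₁ _ h₁ s hs).trans (mul_le_mul_of_nonneg_left (key s hs s₁ hs₁) hN)
      simp only at e1 e2 e3 e4
      rw [abs_sub_comm, abs_of_nonneg (by linarith : 0 ≤ d - c)] at e2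
      have e5 : ‖G (s, d) - G (s, c)‖ ≤ ‖G (s, d) - G (s₂, d)‖ + ‖G (s₂, c) - G (s₂, d)‖
          + ‖G (s₂, c) - G (s₁, c)‖ + ‖G (s, c) - G (s₁, c)‖ := by
        have : G (s, d) - G (s, c) = (G (s, d) - G (s₂, d)) - (G (s₂, c) - G (s₂, d))
          + (G (s₂, c) - G (s₁, c)) - (G (s, c) - G (s₁, c)) := by ring
        rw [this]
        exact (norm_sub_le _ _).trans (add_le_add_left ((norm_add_le _ _).trans
          (add_le_add_left (norm_sub_le _ _) _)) _)
      have e6 := mul_le_mul_of_nonneg_left hasp hN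
      have e7 : N * (d - c) ≤ N * (d' - c') := mul_le_mul_of_nonneg_left (by linarith) hN
      have e8 : 0 ≤ N * (d' - c') := mul_nonneg hN (by linarith)
      linarith
    · have hint : IntegrableOn (fun t => h (s, t)) (Prod.mk s ⁻¹' K) := by
        refine Measure.integrableOn_of_bounded (M := N) ?_
          (hh.comp measurable_prodMk_left).aestronglyMeasurable
          ((ae_restrict_iff' (hslice s).measurableSet).2 (ae_of_all _ fun t ht => hbd _ ht))
        exact ((measure_mono (hsliceI s)).trans_lt measure_Icc_lt_top).ne
      refine (norm_sub_sub_setIntegral_le (f := fun t => G (s, t)) (c := fun t => h (s, t)) hcd hN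
        (hslice s) (hsliceI s) hne (fun t ht x hx => hL₂ _ ht x hx)
        (fun t ht => hder _ ht) hint).trans ?_
      have e1 : volume.real (Icc c d \ Prod.mk s ⁻¹' K)
          ≤ volume.real (Icc c' d' \ Prod.mk s ⁻¹' K) :=
        measureReal_mono (sdiff_subset_sdiff_left (Icc_subset_Icc hc hd))
          ((measure_mono sdiff_subset).trans_lt measure_Icc_lt_top).ne
      refine mul_le_mul (by nlinarith [mul_nonneg hN hρ]) e1 measureReal_nonneg ?_
      exact mul_nonneg hN (by linarith)
  have hGint : IntegrableOn (fun s => G (s, d) - G (s, c)) (Icc a b) :=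
    (by fun_prop : Continuous fun s => G (s, d) - G (s, c)).integrableOn_Icc
  rw [intervalIntegral.integral_of_le hab, ← integral_Icc_eq_integral_Ioc, hFub,
    ← integral_sub hGint hFubint, hvol, ← integral_const_mul]
  refine (norm_integral_le_of_norm_le ((hvolint.mono_set hsub).const_mul _)
    ((ae_restrict_iff' measurableSet_Icc).2 (ae_of_all _ hpt))).trans ?_
  -- The slice bound is nonnegative, so its integral may be enlarged to `[a', b']`.
  refine setIntegral_mono_set (hvolint.const_mul _) (ae_of_all _ fun s => ?_)
    hsub.eventuallyLE
  exact mul_nonneg (mul_nonneg hN (by linarith)) measureReal_nonneg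

/-! ### Boundary integrals over rectangles -/

/-- The integral of `F` over the boundary of the rectangle `[a, b] × [c, d]`. -/
noncomputable def rectIntegral (F : ℂ → ℂ) (a b c d : ℝ) : ℂ :=
  (∫ x in a..b, F (x + c * Complex.I)) - (∫ x in a..b, F (x + d * Complex.I)) +
    Complex.I * (∫ y in c..d, F (b + y * Complex.I)) -
    Complex.I * (∫ y in c..d, F (a + y * Complex.I))

theorem rectIntegral_add_horizontal {F : ℂ → ℂ} (hF : Continuous F) (a m b c d : ℝ) :
    rectIntegral F a m c d + rectIntegral F m b c d = rectIntegral F a b c d := by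
  have h (y u v : ℝ) : IntervalIntegrable (fun x : ℝ => F (x + y * Complex.I))
      MeasureTheory.volume u v :=
    (by fun_prop : Continuous fun x : ℝ => F (x + y * Complex.I)).intervalIntegrable _ _
  unfold rectIntegral
  rw [← intervalIntegral.integral_add_adjacent_intervals (h c a m) (h c m b),
    ← intervalIntegral.integral_add_adjacent_intervals (h d a m) (h d m b)]
  ring

theorem rectIntegral_add_vertical {F : ℂ → ℂ} (hF : Continuous F) (a b c m d : ℝ) :
    rectIntegral F a b c m + rectIntegral F a b m d = rectIntegral F a b c d := by
  have h (x u v : ℝ) : IntervalIntegrable (fun y : ℝ => F (x + y * Complex.I))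
      MeasureTheory.volume u v :=
    (by fun_prop : Continuous fun y : ℝ => F (x + y * Complex.I)).intervalIntegrable _ _
  unfold rectIntegral
  rw [← intervalIntegral.integral_add_adjacent_intervals (h a c m) (h a m d),
    ← intervalIntegral.integral_add_adjacent_intervals (h b c m) (h b m d)]
  ring

open Set in
theorem rectIntegral_eq_zero {F : ℂ → ℂ} (hF : Continuous F) {a b c d : ℝ} (hab : a ≤ b)
    (hcd : c ≤ d)
    (hd : ∀ x ∈ Ioo a b, ∀ y ∈ Ioo c d, DifferentiableAt ℂ F (x + y * Complex.I)) :
    rectIntegral F a b c d = 0 := by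
  refine Complex.integral_boundary_rect_eq_zero_of_continuousOn_of_differentiableOn F ⟨a, c⟩ ⟨b, d⟩
    hF.continuousOn fun z hz => ?_
  simp only [min_eq_left hab, max_eq_right hab, min_eq_left hcd, max_eq_right hcd] at hz
  have := hd _ hz.1 _ hz.2
  rw [Complex.re_add_im] at this
  exact this.differentiableWithinAt

-- The boundary integral is `i` times the integral of horizontal increments minus that of vertical
-- ones. These approximate `∫_K h` and `i ∫_K h` by the Cauchy–Riemann equations, so the main terms
-- cancel and two error terms remain.
open MeasureTheory Set in
theorem norm_rectIntegral_le_of_touching {F : ℂ → ℂ} {h : ℝ × ℝ → ℂ}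
    {a b c d a' b' c' d' N ρ : ℝ}
    {K : Set (ℝ × ℝ)} (hF : Continuous F) (hh : Measurable h) (hN : 0 ≤ N) (hρ : 0 ≤ ρ)
    (hab : a ≤ b) (hcd : c ≤ d) (ha : a' ≤ a) (hb : b ≤ b') (hc : c' ≤ c) (hd : d ≤ d')
    (hasp₁ : b' - a' ≤ ρ * (d' - c')) (hasp₂ : d' - c' ≤ ρ * (b' - a'))
    (hK : IsCompact K) (hKI : K ⊆ Icc a b ×ˢ Icc c d)
    (hleft : ∃ y, (a, y) ∈ K) (hright : ∃ y, (b, y) ∈ K)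
    (hbot : ∃ x, (x, c) ∈ K) (htop : ∃ x, (x, d) ∈ K)
    (hL₁ : ∀ p ∈ K, ∀ x ∈ Icc a b,
      ‖F (x + p.2 * Complex.I) - F (p.1 + p.2 * Complex.I)‖ ≤ N * |x - p.1|)
    (hL₂ : ∀ p ∈ K, ∀ y ∈ Icc c d,
      ‖F (p.1 + y * Complex.I) - F (p.1 + p.2 * Complex.I)‖ ≤ N * |y - p.2|)
    (hder₁ : ∀ p ∈ K, HasDerivAt (fun x : ℝ => F (x + p.2 * Complex.I)) (h p) p.1)
    (hder₂ : ∀ p ∈ K, HasDerivAt (fun y : ℝ => F (p.1 + y * Complex.I)) (Complex.I * h p) p.2)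
    (hbd : ∀ p ∈ K, ‖h p‖ ≤ N) :
    ‖rectIntegral F a b c d‖
      ≤ 2 * (N * (3 * ρ + 6) * volume.real ((Icc a' b' ×ˢ Icc c' d') \ K)) := by
  have h1 := norm_integral_sub_sub_setIntegral_le
    (G := fun p => F (p.1 + p.2 * Complex.I)) (h := fun p => Complex.I * h p) (by fun_prop)
    (hh.const_mul _) hN hρ hab hcd ha hb hc hd hasp₁ hK hKI hbot htop hL₁ hL₂ hder₂
    (by simpa using hbd)
  have hemb : MeasurableEmbedding (Prod.swap : ℝ × ℝ → ℝ × ℝ) :=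
    MeasurableEquiv.prodComm.measurableEmbedding
  have hmp : MeasurePreserving (Prod.swap : ℝ × ℝ → ℝ × ℝ) volume volume :=
    Measure.measurePreserving_swap
  have h2 := norm_integral_sub_sub_setIntegral_le (K := Prod.swap ⁻¹' K)
    (G := fun p => F (p.2 + p.1 * Complex.I)) (h := fun p => h p.swap) (by fun_prop)
    (hh.comp measurable_swap) hN hρ hcd hab hc hd ha hb hasp₂
    ((Homeomorph.prodComm ℝ ℝ).isCompact_preimage.2 hK) (fun p hp => (hKI hp).symm) hleft hright
    (fun p hp => hL₂ _ hp) (fun p hp => hL₁ _ hp) (fun p hp => hder₁ _ hp)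
    (fun p hp => hbd _ hp)
  rw [hmp.setIntegral_preimage_emb hemb h] at h2
  have hv : volume.real ((Icc c' d' ×ˢ Icc a' b') \ (Prod.swap ⁻¹' K))
      = volume.real ((Icc a' b' ×ˢ Icc c' d') \ K) := by
    rw [← hmp.measureReal_preimage (s := (Icc a' b' ×ˢ Icc c' d') \ K)
      (((measurableSet_Icc.prod measurableSet_Icc).diff hK.measurableSet).nullMeasurableSet),
      preimage_sdiff, preimage_swap_prod]
  rw [hv] at h2
  have hx (y : ℝ) : IntervalIntegrable (fun x : ℝ => F (x + y * Complex.I)) volume a b :=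
    (by fun_prop : Continuous fun x : ℝ => F (x + y * Complex.I)).intervalIntegrable _ _
  have hy (x : ℝ) : IntervalIntegrable (fun y : ℝ => F (x + y * Complex.I)) volume c d :=
    (by fun_prop : Continuous fun y : ℝ => F (x + y * Complex.I)).intervalIntegrable _ _
  simp only at h1 h2
  rw [intervalIntegral.integral_sub (hx d) (hx c), integral_const_mul] at h1
  rw [intervalIntegral.integral_sub (hy b) (hy a)] at h2
  have : rectIntegral F a b c d =
      Complex.I * ((∫ y in c..d, F (b + y * Complex.I)) - (∫ y in c..d, F (a + y * Complex.I))
        - ∫ p in K, h p)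
      - ((∫ x in a..b, F (x + d * Complex.I)) - (∫ x in a..b, F (x + c * Complex.I))
        - Complex.I * ∫ p in K, h p) := by
    unfold rectIntegral
    ring
  rw [this]
  refine (norm_sub_le _ _).trans ?_
  rw [norm_mul, Complex.norm_I, one_mul]
  linarith

-- The estimate for touching rectangles needs a point of `K` on every side. Shrinking to the
-- bounding box of `K` achieves this, and the four strips cut off contribute nothing because `F` is
-- holomorphic there.
open MeasureTheory Set in
theorem norm_rectIntegral_le {F : ℂ → ℂ} {h : ℝ × ℝ → ℂ} {a b c d N ρ : ℝ}
    {K : Set (ℝ × ℝ)} (hF : Continuous F) (hh : Measurable h) (hN : 0 ≤ N) (hρ : 0 ≤ ρ)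
    (hab : a ≤ b) (hcd : c ≤ d) (hasp₁ : b - a ≤ ρ * (d - c)) (hasp₂ : d - c ≤ ρ * (b - a))
    (hK : IsCompact K) (hKI : K ⊆ Icc a b ×ˢ Icc c d)
    (hoff : ∀ p ∈ Icc a b ×ˢ Icc c d, p ∉ K → DifferentiableAt ℂ F (p.1 + p.2 * Complex.I))
    (hL₁ : ∀ p ∈ K, ∀ x ∈ Icc a b,
      ‖F (x + p.2 * Complex.I) - F (p.1 + p.2 * Complex.I)‖ ≤ N * |x - p.1|)
    (hL₂ : ∀ p ∈ K, ∀ y ∈ Icc c d,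
      ‖F (p.1 + y * Complex.I) - F (p.1 + p.2 * Complex.I)‖ ≤ N * |y - p.2|)
    (hder₁ : ∀ p ∈ K, HasDerivAt (fun x : ℝ => F (x + p.2 * Complex.I)) (h p) p.1)
    (hder₂ : ∀ p ∈ K, HasDerivAt (fun y : ℝ => F (p.1 + y * Complex.I)) (Complex.I * h p) p.2)
    (hbd : ∀ p ∈ K, ‖h p‖ ≤ N) :
    ‖rectIntegral F a b c d‖
      ≤ 2 * (N * (3 * ρ + 6) * volume.real ((Icc a b ×ˢ Icc c d) \ K)) := by
  rcases K.eq_empty_or_nonempty with rfl | hne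
  · rw [rectIntegral_eq_zero hF hab hcd fun x hx y hy =>
      hoff (x, y) ⟨Ioo_subset_Icc_self hx, Ioo_subset_Icc_self hy⟩ (notMem_empty _), norm_zero]
    have : 0 ≤ N * (3 * ρ + 6) := mul_nonneg hN (by linarith)
    positivity
  obtain ⟨p, hp, hp'⟩ := hK.exists_isMinOn hne continuous_fst.continuousOn
  obtain ⟨q, hq, hq'⟩ := hK.exists_isMaxOn hne continuous_fst.continuousOn
  obtain ⟨r, hr, hr'⟩ := hK.exists_isMinOn hne continuous_snd.continuousOn
  obtain ⟨s, hs, hs'⟩ := hK.exists_isMaxOn hne continuous_snd.continuousOn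
  have hpI := hKI hp
  have hqI := hKI hq
  have hrI := hKI hr
  have hsI := hKI hs
  have hpq : p.1 ≤ q.1 := hp' hq
  have hrs : r.2 ≤ s.2 := hr' hs
  have zero : ∀ a₁ b₁ c₁ d₁ : ℝ, a ≤ a₁ → a₁ ≤ b₁ → b₁ ≤ b → c ≤ c₁ → c₁ ≤ d₁ → d₁ ≤ d →
      (∀ u ∈ K, u.1 ∈ Ioo a₁ b₁ → u.2 ∈ Ioo c₁ d₁ → False) → rectIntegral F a₁ b₁ c₁ d₁ = 0 :=
    fun a₁ b₁ c₁ d₁ h1 h2 h3 h4 h5 h6 h7 => rectIntegral_eq_zero hF h2 h5 fun x hx y hy =>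
      hoff (x, y) ⟨⟨h1.trans hx.1.le, hx.2.le.trans h3⟩, ⟨h4.trans hy.1.le, hy.2.le.trans h6⟩⟩
        fun hu => h7 _ hu hx hy
  have heq : rectIntegral F a b c d = rectIntegral F p.1 q.1 r.2 s.2 := by
    rw [← rectIntegral_add_horizontal hF a p.1 b, ← rectIntegral_add_horizontal hF p.1 q.1 b,
      ← rectIntegral_add_vertical hF p.1 q.1 c r.2 d,
      ← rectIntegral_add_vertical hF p.1 q.1 r.2 s.2 d,
      zero a p.1 c d le_rfl hpI.1.1 hpI.1.2 le_rfl hcd le_rfl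
        fun u hu h1 _ => not_le.2 h1.2 (hp' hu),
      zero q.1 b c d hqI.1.1 hqI.1.2 le_rfl le_rfl hcd le_rfl
        fun u hu h1 _ => not_le.2 h1.1 (hq' hu),
      zero p.1 q.1 c r.2 hpI.1.1 hpq hqI.1.2 le_rfl hrI.2.1 hrI.2.2
        fun u hu _ h1 => not_le.2 h1.2 (hr' hu),
      zero p.1 q.1 s.2 d hpI.1.1 hpq hqI.1.2 hsI.2.1 hsI.2.2 le_rfl
        fun u hu _ h1 => not_le.2 h1.1 (hs' hu)]
    ring
  rw [heq]
  exact norm_rectIntegral_le_of_touching hF hh hN hρ hpq hrs hpI.1.1 hqI.1.2 hrI.2.1 hsI.2.2 hasp₁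
    hasp₂ hK (fun u hu => ⟨⟨hp' hu, hq' hu⟩, ⟨hr' hu, hs' hu⟩⟩) ⟨_, hp⟩ ⟨_, hq⟩ ⟨_, hr⟩ ⟨_, hs⟩
    (fun u hu x hx => hL₁ u hu x ⟨hpI.1.1.trans hx.1, hx.2.trans hqI.1.2⟩)
    (fun u hu y hy => hL₂ u hu y ⟨hrI.2.1.trans hy.1, hy.2.trans hsI.2.2⟩) hder₁ hder₂ hbd

open MeasureTheory Set in
theorem measureReal_Ioc_prod_Ioc_add (ν : Measure (ℝ × ℝ)) [IsFiniteMeasure ν] {a m b c n d : ℝ}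
    (ham : a ≤ m) (hmb : m ≤ b) (hcn : c ≤ n) (hnd : n ≤ d) :
    ν.real (Ioc a m ×ˢ Ioc c n) + ν.real (Ioc m b ×ˢ Ioc c n) + ν.real (Ioc a m ×ˢ Ioc n d)
      + ν.real (Ioc m b ×ˢ Ioc n d) = ν.real (Ioc a b ×ˢ Ioc c d) := by
  have h₁ (s : Set ℝ) (hs : MeasurableSet s) :
      ν.real (Ioc a m ×ˢ s) + ν.real (Ioc m b ×ˢ s) = ν.real (Ioc a b ×ˢ s) := by
    rw [← measureReal_union (Set.Disjoint.set_prod_left (Ioc_disjoint_Ioc_of_le le_rfl) _ _)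
      (measurableSet_Ioc.prod hs), ← union_prod, Ioc_union_Ioc_eq_Ioc ham hmb]
  rw [h₁ _ measurableSet_Ioc, add_assoc, h₁ _ measurableSet_Ioc,
    ← measureReal_union (Set.Disjoint.set_prod_right (Ioc_disjoint_Ioc_of_le le_rfl) _ _)
      (measurableSet_Ioc.prod measurableSet_Ioc), ← prod_union, Ioc_union_Ioc_eq_Ioc hcn hnd]

-- Bisecting both sides `n` times, the boundary integrals and `ν` both add over the four quarters.
-- Half-open boxes make the additivity of `ν` exact.
open MeasureTheory Set in
theorem norm_rectIntegral_le_of_small {F : ℂ → ℂ} (hF : Continuous F) (ν : Measure (ℝ × ℝ))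
    [IsFiniteMeasure ν] (R : Set (ℝ × ℝ)) {M : ℝ} (n : ℕ) :
    ∀ {p q : ℝ}, 0 ≤ p → 0 ≤ q →
    (∀ a c, Icc a (a + p) ×ˢ Icc c (c + q) ⊆ R →
      ‖rectIntegral F a (a + p) c (c + q)‖ ≤ M * ν.real (Ioc a (a + p) ×ˢ Ioc c (c + q))) →
    ∀ a c, Icc a (a + 2 ^ n * p) ×ˢ Icc c (c + 2 ^ n * q) ⊆ R →
      ‖rectIntegral F a (a + 2 ^ n * p) c (c + 2 ^ n * q)‖
        ≤ M * ν.real (Ioc a (a + 2 ^ n * p) ×ˢ Ioc c (c + 2 ^ n * q)) := by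
  induction n with
  | zero =>
    intro p q _ _ h
    simpa using h
  | succ n ih =>
    intro p q hp hq h a c hR
    rw [pow_succ, mul_assoc, mul_assoc] at hR ⊢
    refine ih (by positivity) (by positivity) (fun a c hR => ?_) a c hR
    have h₁ := h a c ((Set.prod_mono (Icc_subset_Icc le_rfl (by linarith))
      (Icc_subset_Icc le_rfl (by linarith))).trans hR)
    have h₂ := h (a + p) c ((Set.prod_mono (Icc_subset_Icc (by linarith) (by linarith))
      (Icc_subset_Icc le_rfl (by linarith))).trans hR)
    have h₃ := h a (c + q) ((Set.prod_mono (Icc_subset_Icc le_rfl (by linarith))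
      (Icc_subset_Icc (by linarith) (by linarith))).trans hR)
    have h₄ := h (a + p) (c + q) ((Set.prod_mono (Icc_subset_Icc (by linarith) (by linarith))
      (Icc_subset_Icc (by linarith) (by linarith))).trans hR)
    have ea : a + p + p = a + 2 * p := by ring
    have ec : c + q + q = c + 2 * q := by ring
    rw [ea] at h₂
    rw [ec] at h₃
    rw [ea, ec] at h₄
    rw [← rectIntegral_add_vertical hF a (a + 2 * p) c (c + q) (c + 2 * q),
      ← rectIntegral_add_horizontal hF a (a + p) (a + 2 * p) c,
      ← rectIntegral_add_horizontal hF a (a + p) (a + 2 * p) (c + q),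
      ← measureReal_Ioc_prod_Ioc_add ν (a := a) (m := a + p) (b := a + 2 * p) (c := c) (n := c + q)
        (d := c + 2 * q) (by linarith) (by linarith) (by linarith) (by linarith)]
    refine (norm_add_le _ _).trans ((add_le_add (norm_add_le _ _) (norm_add_le _ _)).trans ?_)
    linarith

open MeasureTheory Set in
theorem tendsto_measureReal_cthickening_sdiff {K : Set (ℝ × ℝ)} (hK : IsCompact K) :
    Tendsto (fun δ => volume.real (Metric.cthickening δ K \ K)) (𝓝[>] 0) (𝓝 0) := by
  have h1 := (tendsto_measure_cthickening_of_isCompact (μ := (volume : Measure (ℝ × ℝ))) hK).mono_left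
    (nhdsWithin_le_nhds (s := Ioi 0))
  have h2 : Tendsto (fun δ => volume (Metric.cthickening δ K \ K)) (𝓝[>] 0) (𝓝 0) := by
    have h3 := ENNReal.Tendsto.sub h1 (tendsto_const_nhds (x := volume K))
      (Or.inl hK.measure_lt_top.ne)
    rw [tsub_self] at h3
    refine h3.congr fun δ => ?_
    rw [measure_sdiff (Metric.self_subset_cthickening K) hK.measurableSet.nullMeasurableSet
      hK.measure_lt_top.ne]
  exact (ENNReal.tendsto_toReal ENNReal.zero_ne_top).comp h2

-- On a grid of mesh at most `δ`, cells missing `K` contribute zero, and cells meeting `K` lie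
-- within `δ` of it. Their bounds sum to at most `M` times the area of the `δ`-neighbourhood of `K`
-- minus `K`, and `δ` tends to zero.
open MeasureTheory Set in
theorem rectIntegral_eq_zero_of_lipschitz {F : ℂ → ℂ} {h : ℝ × ℝ → ℂ} {a b c d N : ℝ}
    {K : Set (ℝ × ℝ)} (hF : Continuous F) (hh : Measurable h) (hN : 0 ≤ N)
    (hab : a < b) (hcd : c < d) (hK : IsCompact K)
    (hoff : ∀ p ∈ Icc a b ×ˢ Icc c d, p ∉ K → DifferentiableAt ℂ F (p.1 + p.2 * Complex.I))
    (hL₁ : ∀ p ∈ K, ∀ x ∈ Icc a b,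
      ‖F (x + p.2 * Complex.I) - F (p.1 + p.2 * Complex.I)‖ ≤ N * |x - p.1|)
    (hL₂ : ∀ p ∈ K, ∀ y ∈ Icc c d,
      ‖F (p.1 + y * Complex.I) - F (p.1 + p.2 * Complex.I)‖ ≤ N * |y - p.2|)
    (hder₁ : ∀ p ∈ K, HasDerivAt (fun x : ℝ => F (x + p.2 * Complex.I)) (h p) p.1)
    (hder₂ : ∀ p ∈ K, HasDerivAt (fun y : ℝ => F (p.1 + y * Complex.I)) (Complex.I * h p) p.2)
    (hbd : ∀ p ∈ K, ‖h p‖ ≤ N) :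
    rectIntegral F a b c d = 0 := by
  have hba : 0 < b - a := by linarith
  have hdc : 0 < d - c := by linarith
  -- Bounds the side ratio both ways, and is unchanged by bisection.
  set ρ : ℝ := (b - a) / (d - c) + (d - c) / (b - a) with hρd
  have hρ : 0 ≤ ρ := by positivity
  have hρ₁ : b - a ≤ ρ * (d - c) := by
    rw [hρd, add_mul, div_mul_cancel₀ _ hdc.ne']
    exact le_add_of_nonneg_right (by positivity)
  have hρ₂ : d - c ≤ ρ * (b - a) := by
    rw [hρd, add_mul, div_mul_cancel₀ _ hba.ne']
    exact le_add_of_nonneg_left (by positivity)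
  set M : ℝ := 2 * (N * (3 * ρ + 6)) with hM
  have hM0 : 0 ≤ M := by positivity
  have key : ∀ δ > 0, ‖rectIntegral F a b c d‖
      ≤ M * volume.real (Metric.cthickening δ K \ K) := by
    intro δ hδ
    have hTfin : volume (Metric.cthickening δ K \ K) < ⊤ :=
      (measure_mono sdiff_subset).trans_lt hK.isBounded.cthickening.measure_lt_top
    have hTm : MeasurableSet (Metric.cthickening δ K \ K) :=
      Metric.isClosed_cthickening.measurableSet.diff hK.measurableSet
    have : IsFiniteMeasure (volume.restrict (Metric.cthickening δ K \ K)) :=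
      ⟨by rwa [Measure.restrict_apply_univ]⟩
    obtain ⟨n, hn⟩ := exists_nat_gt (((b - a) + (d - c)) / δ)
    have h2n : (0 : ℝ) < 2 ^ n := by positivity
    have hn' : (b - a) + (d - c) ≤ 2 ^ n * δ := by
      rw [div_lt_iff₀ hδ] at hn
      have : (n : ℝ) ≤ 2 ^ n := by exact_mod_cast Nat.lt_two_pow_self.le
      exact hn.le.trans (mul_le_mul_of_nonneg_right this hδ.le)
    have hp : (b - a) / 2 ^ n ≤ δ := by rw [div_le_iff₀ h2n]; linarith
    have hq : (d - c) / 2 ^ n ≤ δ := by rw [div_le_iff₀ h2n]; linarith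
    have hp0 : 0 ≤ (b - a) / 2 ^ n := by positivity
    have hq0 : 0 ≤ (d - c) / 2 ^ n := by positivity
    have main := norm_rectIntegral_le_of_small hF
      (volume.restrict (Metric.cthickening δ K \ K)) (Icc a b ×ˢ Icc c d) (M := M) n hp0 hq0
      (fun a₁ c₁ hR => ?_) a c ?_
    · rw [mul_div_cancel₀ _ h2n.ne', mul_div_cancel₀ _ h2n.ne', add_sub_cancel,
        add_sub_cancel] at main
      refine main.trans (mul_le_mul_of_nonneg_left ?_ hM0)
      rw [measureReal_restrict_apply (measurableSet_Ioc.prod measurableSet_Ioc)]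
      exact measureReal_mono inter_subset_right hTfin.ne
    · set p := (b - a) / 2 ^ n
      set q := (d - c) / 2 ^ n
      set Q := Icc a₁ (a₁ + p) ×ˢ Icc c₁ (c₁ + q) with hQ
      have hx : Icc a₁ (a₁ + p) ⊆ Icc a b := fun x hx =>
        (hR (⟨hx, left_mem_Icc.2 (by linarith)⟩ : (x, c₁) ∈ Q)).1
      have hy : Icc c₁ (c₁ + q) ⊆ Icc c d := fun y hy =>
        (hR (⟨left_mem_Icc.2 (by linarith), hy⟩ : (a₁, y) ∈ Q)).2
      have hQT : volume.real (Q ∩ (Metric.cthickening δ K \ K)) =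
          (volume.restrict (Metric.cthickening δ K \ K)).real
            (Ioc a₁ (a₁ + p) ×ˢ Ioc c₁ (c₁ + q)) := by
        rw [← measureReal_restrict_apply (measurableSet_Icc.prod measurableSet_Icc)]
        refine measureReal_congr (ae_restrict_of_ae ?_)
        rw [Measure.volume_eq_prod]
        exact Measure.set_prod_ae_eq Ioc_ae_eq_Icc.symm Ioc_ae_eq_Icc.symm
      rw [← hQT]
      rcases (K ∩ Q).eq_empty_or_nonempty with he | ⟨u, huK, huQ⟩
      · rw [rectIntegral_eq_zero hF (by linarith) (by linarith) fun x hx y hy => ?_, norm_zero]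
        · positivity
        · have hmem : (x, y) ∈ Q := ⟨Ioo_subset_Icc_self hx, Ioo_subset_Icc_self hy⟩
          exact hoff (x, y) (hR hmem) fun hk => he.le ⟨hk, hmem⟩
      · have hsub : Q \ (K ∩ Q) ⊆ Q ∩ (Metric.cthickening δ K \ K) := by
          intro v hv
          refine ⟨hv.1, Metric.mem_cthickening_of_dist_le v u δ K huK ?_, fun hk => hv.2 ⟨hk, hv.1⟩⟩
          -- The product carries the sup metric, so two points of one cell are at distance at most
          -- `δ`.
          rw [Prod.dist_eq, Real.dist_eq, Real.dist_eq]
          have h1 := hv.1.1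
          have h2 := hv.1.2
          have h3 := huQ.1
          have h4 := huQ.2
          refine max_le (abs_le.2 ⟨?_, ?_⟩) (abs_le.2 ⟨?_, ?_⟩) <;>
            linarith [h1.1, h1.2, h2.1, h2.2, h3.1, h3.2, h4.1, h4.2]
        have hr₁ : a₁ + p - a₁ ≤ ρ * (c₁ + q - c₁) := by
          rw [add_sub_cancel_left, add_sub_cancel_left, ← mul_div_assoc]
          exact div_le_div_of_nonneg_right hρ₁ h2n.le
        have hr₂ : c₁ + q - c₁ ≤ ρ * (a₁ + p - a₁) := by
          rw [add_sub_cancel_left, add_sub_cancel_left, ← mul_div_assoc]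
          exact div_le_div_of_nonneg_right hρ₂ h2n.le
        refine (norm_rectIntegral_le hF hh hN hρ (by linarith) (by linarith) hr₁ hr₂
          (hK.inter_right (isClosed_Icc.prod isClosed_Icc)) inter_subset_right
          (fun v hv hk => hoff v (hR hv) fun h' => hk ⟨h', hv⟩)
          (fun v hv x hx' => hL₁ v hv.1 x (hx hx')) (fun v hv y hy' => hL₂ v hv.1 y (hy hy'))
          (fun v hv => hder₁ v hv.1) (fun v hv => hder₂ v hv.1)
          (fun v hv => hbd v hv.1)).trans ?_
        rw [← mul_assoc]
        refine mul_le_mul_of_nonneg_left (measureReal_mono hsub ?_) hM0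
        exact ((measure_mono inter_subset_right).trans_lt hTfin).ne
    · rw [mul_div_cancel₀ _ h2n.ne', mul_div_cancel₀ _ h2n.ne', add_sub_cancel, add_sub_cancel]
  have hlim := (tendsto_measureReal_cthickening_sdiff hK).const_mul M
  rw [mul_zero] at hlim
  exact norm_le_zero_iff.1 (ge_of_tendsto hlim (eventually_mem_nhdsWithin.mono fun δ hδ => key δ hδ))

/-! ### The Looman–Menchoff theorem -/

theorem rectIntegral_swap_horizontal (F : ℂ → ℂ) (a b c d : ℝ) :
    rectIntegral F b a c d = -rectIntegral F a b c d := by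
  unfold rectIntegral
  rw [intervalIntegral.integral_symm a b, intervalIntegral.integral_symm a b]
  ring

theorem rectIntegral_swap_vertical (F : ℂ → ℂ) (a b c d : ℝ) :
    rectIntegral F a b d c = -rectIntegral F a b c d := by
  unfold rectIntegral
  rw [intervalIntegral.integral_symm c d, intervalIntegral.integral_symm c d]
  ring

-- Conservativity compares wedge integrals between opposite corners in any order; reversing an order
-- only changes the sign of the boundary integral.
open Set in
theorem isConservativeOn_of_rectIntegral {F : ℂ → ℂ} {V : Set ℂ}
    (h : ∀ a b c d : ℝ, a < b → c < d →
      (∀ x ∈ Icc a b, ∀ y ∈ Icc c d, (x + y * Complex.I : ℂ) ∈ V) → rectIntegral F a b c d = 0) :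
    Complex.IsConservativeOn F V := by
  have h' : ∀ a b c d : ℝ, c < d →
      (∀ x ∈ uIcc a b, ∀ y ∈ Icc c d, (x + y * Complex.I : ℂ) ∈ V) →
      rectIntegral F a b c d = 0 := by
    intro a b c d hcd hV
    rcases lt_trichotomy a b with hab | rfl | hab
    · exact h a b c d hab hcd (by rwa [uIcc_of_le hab.le] at hV)
    · simp [rectIntegral]
    · rw [rectIntegral_swap_horizontal, neg_eq_zero]
      exact h b a c d hab hcd (by rwa [uIcc_of_ge hab.le] at hV)
  have h'' : ∀ a b c d : ℝ,
      (∀ x ∈ uIcc a b, ∀ y ∈ uIcc c d, (x + y * Complex.I : ℂ) ∈ V) →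
      rectIntegral F a b c d = 0 := by
    intro a b c d hV
    rcases lt_trichotomy c d with hcd | rfl | hcd
    · exact h' a b c d hcd (by rwa [uIcc_of_le hcd.le] at hV)
    · simp [rectIntegral]
    · rw [rectIntegral_swap_vertical, neg_eq_zero]
      exact h' a b d c hcd (by rwa [uIcc_of_ge hcd.le] at hV)
  intro z w hzw
  rw [← add_eq_zero_iff_eq_neg, Complex.wedgeIntegral_add_wedgeIntegral_eq]
  refine h'' z.re w.re z.im w.im fun x hx y hy => hzw ?_
  rw [Complex.Rectangle, Complex.mem_reProdIm]
  simpa using ⟨hx, hy⟩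

/-- The **Looman–Menchoff theorem** for a function that is continuous on the whole plane. -/
theorem differentiableOn_of_continuous_of_cauchyRiemann {F g : ℂ → ℂ} {U : Set ℂ} (hU : IsOpen U)
    (hF : Continuous F)
    (hd₁ : ∀ z ∈ U, HasDerivAt (fun t : ℝ => F (z + t)) (g z) 0)
    (hd₂ : ∀ z ∈ U, HasDerivAt (fun t : ℝ => F (z + t * Complex.I)) (Complex.I * g z) 0) :
    DifferentiableOn ℂ F U := by
  suffices hE : U ∩ {z | AnalyticAt ℂ F z}ᶜ = ∅ by
    intro z hz
    by_contra hna
    exact hE.le ⟨hz, fun ha => hna ha.differentiableAt.differentiableWithinAt⟩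
  by_contra hE
  rw [← Ne, ← Set.nonempty_iff_ne_empty] at hE
  have hH : IsOpen {z | AnalyticAt ℂ F z} := isOpen_analyticAt ℂ F
  set E := U ∩ {z | AnalyticAt ℂ F z}ᶜ with hEdef
  -- Local closedness makes `E` locally compact, hence a Baire space.
  have hlc : IsLocallyClosed E := hU.isLocallyClosed.inter hH.isClosed_compl.isLocallyClosed
  have : LocallyCompactSpace E := hlc.locallyCompactSpace
  have : Nonempty E := hE.to_subtype
  -- One integer controls both the slope and the range of `t`. These sets are closed because `F` is
  -- continuous on the whole plane, even where `z + t` leaves `U`.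
  let A : ℕ → Set E := fun n => {z | ∀ t : ℝ, |t| ≤ 1 / ((n : ℝ) + 1) →
    ‖F (z + t) - F z‖ ≤ ((n : ℝ) + 1) * |t| ∧
    ‖F (z + t * Complex.I) - F z‖ ≤ ((n : ℝ) + 1) * |t|}
  have hAc : ∀ n, IsClosed (A n) := by
    intro n
    have hA : A n = ⋂ (t : ℝ) (_ : |t| ≤ 1 / ((n : ℝ) + 1)),
        {z : E | ‖F (z + t) - F z‖ ≤ ((n : ℝ) + 1) * |t|} ∩
        {z : E | ‖F (z + t * Complex.I) - F z‖ ≤ ((n : ℝ) + 1) * |t|} := by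
      ext z
      simp [A]
    rw [hA]
    refine isClosed_iInter fun t => isClosed_iInter fun _ => IsClosed.inter ?_ ?_ <;>
      exact isClosed_le (by fun_prop) (by fun_prop)
  have hlip : ∀ {f : ℝ → ℂ} {f' : ℂ}, HasDerivAt f f' 0 → ∃ C δ : ℝ, 0 < δ ∧
      ∀ t : ℝ, |t| < δ → ‖f t - f 0‖ ≤ C * |t| := by
    intro f f' hf
    obtain ⟨C, hC⟩ := hf.isBigO_sub.bound
    obtain ⟨δ, hδ, hb⟩ := Metric.eventually_nhds_iff.1 hC
    refine ⟨C, δ, hδ, fun t ht => ?_⟩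
    have := hb (y := t) (by rwa [Real.dist_eq, sub_zero])
    rwa [sub_zero, Real.norm_eq_abs] at this
  have hAu : ⋃ n, A n = Set.univ := by
    refine Set.eq_univ_of_forall fun z => Set.mem_iUnion.2 ?_
    obtain ⟨C₁, δ₁, hδ₁, h₁⟩ := hlip (hd₁ z z.2.1)
    obtain ⟨C₂, δ₂, hδ₂, h₂⟩ := hlip (hd₂ z z.2.1)
    obtain ⟨n, hn⟩ := exists_nat_gt (max (max C₁ C₂) (max (1 / δ₁) (1 / δ₂)))
    rw [max_lt_iff, max_lt_iff, max_lt_iff] at hn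
    obtain ⟨⟨hn₁, hn₂⟩, hn₃, hn₄⟩ := hn
    refine ⟨n, fun t ht => ?_⟩
    have e₁ : |t| < δ₁ := by
      refine ht.trans_lt ?_
      rw [one_div_lt (by positivity) hδ₁]
      linarith
    have e₂ : |t| < δ₂ := by
      refine ht.trans_lt ?_
      rw [one_div_lt (by positivity) hδ₂]
      linarith
    have i₁ := h₁ t e₁
    have i₂ := h₂ t e₂
    simp only [Complex.ofReal_zero, zero_mul, add_zero] at i₁ i₂
    exact ⟨i₁.trans (mul_le_mul_of_nonneg_right (by linarith) (abs_nonneg t)),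
      i₂.trans (mul_le_mul_of_nonneg_right (by linarith) (abs_nonneg t))⟩
  obtain ⟨n, z₁, hz₁⟩ := nonempty_interior_of_iUnion_of_closed hAc hAu
  rw [mem_interior_iff_mem_nhds, nhds_subtype_eq_comap, Filter.mem_comap] at hz₁
  obtain ⟨O, hO, hOA⟩ := hz₁
  set N : ℝ := (n : ℝ) + 1 with hNdef
  have hN : 0 < N := by positivity
  obtain ⟨η, hη, hball⟩ := Metric.mem_nhds_iff.1 (Filter.inter_mem hO (hU.mem_nhds z₁.2.1))
  -- The disc has diameter at most `1 / N`, so the bounds defining `A n` reach across any rectangle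
  -- inside it.
  set r := min η (1 / (2 * N)) with hr
  have hr0 : 0 < r := lt_min hη (by positivity)
  have hrN : 2 * r ≤ 1 / N := by
    have : r ≤ 1 / (2 * N) := min_le_right _ _
    calc 2 * r ≤ 2 * (1 / (2 * N)) := by linarith
      _ = 1 / N := by field_simp
  have hVU : ∀ z ∈ Metric.ball (z₁ : ℂ) r, z ∈ O ∧ z ∈ U := fun z hz =>
    hball (Metric.ball_subset_ball (min_le_left _ _) hz)
  have hAV : ∀ z ∈ Metric.ball (z₁ : ℂ) r, ¬ AnalyticAt ℂ F z → ∀ t : ℝ, |t| ≤ 1 / N →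
      ‖F (z + t) - F z‖ ≤ N * |t| ∧ ‖F (z + t * Complex.I) - F z‖ ≤ N * |t| :=
    fun z hz hna => hOA (a := ⟨z, (hVU z hz).2, hna⟩) (hVU z hz).1
  have hcons : Complex.IsConservativeOn F (Metric.ball (z₁ : ℂ) r) := by
    refine isConservativeOn_of_rectIntegral fun a b c d hab hcd hV => ?_
    have hd₁' : ∀ x y : ℝ, (x + y * Complex.I : ℂ) ∈ U →
        HasDerivAt (fun s : ℝ => F (s + y * Complex.I)) (g (x + y * Complex.I)) x := by
      intro x y hz
      have := HasDerivAt.comp_sub_const (f := fun t : ℝ => F (x + y * Complex.I + t)) x x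
        (by rw [sub_self]; exact hd₁ _ hz)
      refine this.congr_of_eventuallyEq (Eventually.of_forall fun s => congrArg F ?_)
      push_cast
      ring
    have hd₂' : ∀ x y : ℝ, (x + y * Complex.I : ℂ) ∈ U →
        HasDerivAt (fun s : ℝ => F (x + s * Complex.I))
          (Complex.I * g (x + y * Complex.I)) y := by
      intro x y hz
      have := HasDerivAt.comp_sub_const
        (f := fun t : ℝ => F (x + y * Complex.I + t * Complex.I)) y y
        (by rw [sub_self]; exact hd₂ _ hz)
      refine this.congr_of_eventuallyEq (Eventually.of_forall fun s => congrArg F ?_)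
      push_cast
      ring
    have hb : b - a ≤ 1 / N := by
      have h1 := hV a (Set.left_mem_Icc.2 hab.le) c (Set.left_mem_Icc.2 hcd.le)
      have h2 := hV b (Set.right_mem_Icc.2 hab.le) c (Set.left_mem_Icc.2 hcd.le)
      have h3 := (dist_triangle_right (b + c * Complex.I : ℂ) (a + c * Complex.I) z₁).trans_lt
        (add_lt_add h2 h1)
      have h4 := Complex.abs_re_le_norm ((b + c * Complex.I : ℂ) - (a + c * Complex.I))
      rw [← dist_eq_norm] at h4
      simp only [Complex.sub_re, Complex.add_re, Complex.ofReal_re, Complex.mul_re, Complex.I_re,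
        Complex.ofReal_im, Complex.I_im] at h4
      have h5 := le_abs_self (b + (c * 0 - 0 * 1) - (a + (c * 0 - 0 * 1)))
      linarith
    have hdc : d - c ≤ 1 / N := by
      have h1 := hV a (Set.left_mem_Icc.2 hab.le) c (Set.left_mem_Icc.2 hcd.le)
      have h2 := hV a (Set.left_mem_Icc.2 hab.le) d (Set.right_mem_Icc.2 hcd.le)
      have h3 := (dist_triangle_right (a + d * Complex.I : ℂ) (a + c * Complex.I) z₁).trans_lt
        (add_lt_add h2 h1)
      have h4 := Complex.abs_im_le_norm ((a + d * Complex.I : ℂ) - (a + c * Complex.I))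
      rw [← dist_eq_norm] at h4
      simp only [Complex.sub_im, Complex.add_im, Complex.ofReal_re, Complex.mul_im, Complex.I_re,
        Complex.ofReal_im, Complex.I_im] at h4
      have h5 := le_abs_self (0 + (d * 1 + 0 * 0) - (0 + (c * 1 + 0 * 0)))
      linarith
    -- Nothing is known about the measurability of `g`; the derivative of a continuous function with
    -- a parameter is measurable and agrees with `g` on `U`.
    let h : ℝ × ℝ → ℂ := fun p => deriv (fun s : ℝ => F (s + p.2 * Complex.I)) p.1
    have hh : Measurable h := by
      have hc : Continuous (Function.uncurry fun y s : ℝ => F (s + y * Complex.I)) := by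
        change Continuous fun p : ℝ × ℝ => F (p.2 + p.1 * Complex.I)
        fun_prop
      exact (measurable_deriv_with_param hc).comp measurable_swap
    have hhg : ∀ p : ℝ × ℝ, (p.1 + p.2 * Complex.I : ℂ) ∈ U → h p = g (p.1 + p.2 * Complex.I) :=
      fun p hp => (hd₁' _ _ hp).deriv
    let K : Set (ℝ × ℝ) := (Set.Icc a b ×ˢ Set.Icc c d) ∩
      (fun p : ℝ × ℝ => (p.1 + p.2 * Complex.I : ℂ)) ⁻¹' {z | AnalyticAt ℂ F z}ᶜ
    have hK : IsCompact K :=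
      (isCompact_Icc.prod isCompact_Icc).inter_right (hH.isClosed_compl.preimage (by fun_prop))
    have hKV : ∀ p ∈ K, (p.1 + p.2 * Complex.I : ℂ) ∈ Metric.ball (z₁ : ℂ) r :=
      fun p hp => hV _ hp.1.1 _ hp.1.2
    have hL₁ : ∀ p ∈ K, ∀ x, |x - p.1| ≤ 1 / N →
        ‖F (x + p.2 * Complex.I) - F (p.1 + p.2 * Complex.I)‖ ≤ N * |x - p.1| := by
      intro p hp x hx
      have := (hAV _ (hKV p hp) hp.2 (x - p.1) hx).1
      rwa [show (p.1 + p.2 * Complex.I + (x - p.1 : ℝ) : ℂ) = x + p.2 * Complex.I by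
        push_cast; ring] at this
    have hL₂ : ∀ p ∈ K, ∀ y, |y - p.2| ≤ 1 / N →
        ‖F (p.1 + y * Complex.I) - F (p.1 + p.2 * Complex.I)‖ ≤ N * |y - p.2| := by
      intro p hp y hy
      have := (hAV _ (hKV p hp) hp.2 (y - p.2) hy).2
      rwa [show (p.1 + p.2 * Complex.I + (y - p.2 : ℝ) * Complex.I : ℂ) = p.1 + y * Complex.I by
        push_cast; ring] at this
    have hder₁ : ∀ p ∈ K, HasDerivAt (fun x : ℝ => F (x + p.2 * Complex.I)) (h p) p.1 :=
      fun p hp => (hhg p (hVU _ (hKV p hp)).2) ▸ hd₁' _ _ (hVU _ (hKV p hp)).2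
    have hder₂ : ∀ p ∈ K,
        HasDerivAt (fun y : ℝ => F (p.1 + y * Complex.I)) (Complex.I * h p) p.2 :=
      fun p hp => (hhg p (hVU _ (hKV p hp)).2) ▸ hd₂' _ _ (hVU _ (hKV p hp)).2
    refine rectIntegral_eq_zero_of_lipschitz hF hh hN.le hab hcd hK
      (fun p hp hpK => ?_) (fun p hp x hx => hL₁ p hp x ?_) (fun p hp y hy => hL₂ p hp y ?_)
      hder₁ hder₂ (fun p hp => ?_)
    · by_contra hna
      exact hpK ⟨hp, fun ha => hna ha.differentiableAt⟩
    · have := hp.1.1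
      exact abs_le.2 ⟨by linarith [hx.1, this.2], by linarith [hx.2, this.1]⟩
    · have := hp.1.2
      exact abs_le.2 ⟨by linarith [hy.1, this.2], by linarith [hy.2, this.1]⟩
    · refine (hder₁ p hp).le_of_lip' hN.le ?_
      filter_upwards [Metric.closedBall_mem_nhds p.1 (by positivity : 0 < 1 / N)] with x hx
      exact hL₁ p hp x hx
  have hdiff := (Complex.isConservativeOn_and_continuousOn_iff_isDifferentiableOn
    Metric.isOpen_ball).1 ⟨hcons, hF.continuousOn⟩
  exact z₁.2.2 (hdiff.analyticAt (Metric.ball_mem_nhds _ hr0))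

/-- The **Looman–Menchoff theorem**: a continuous function on an open set which has partial
derivatives satisfying the Cauchy–Riemann equations at every point is holomorphic. -/
theorem differentiableOn_of_continuousOn_of_cauchyRiemann {F g : ℂ → ℂ} {U : Set ℂ}
    (hU : IsOpen U) (hF : ContinuousOn F U)
    (hd₁ : ∀ z ∈ U, HasDerivAt (fun t : ℝ => F (z + t)) (g z) 0)
    (hd₂ : ∀ z ∈ U, HasDerivAt (fun t : ℝ => F (z + t * Complex.I)) (Complex.I * g z) 0) :
    DifferentiableOn ℂ F U := by
  intro z₀ hz₀
  obtain ⟨r, hr, hball⟩ := Metric.nhds_basis_closedBall.mem_iff.1 (hU.mem_nhds hz₀)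
  -- The statement is local, so Tietze extension from a closed disc reduces it to a function
  -- continuous on the plane.
  obtain ⟨G, hG⟩ := ContinuousMap.exists_restrict_eq
    (Metric.isClosed_closedBall (x := z₀) (ε := r))
    ⟨(Metric.closedBall z₀ r).domRestrict F, (hF.mono hball).domRestrict⟩
  have hGF : ∀ z ∈ Metric.closedBall z₀ r, G z = F z := fun z hz =>
    congrArg (fun f : C(Metric.closedBall z₀ r, ℂ) => f ⟨z, hz⟩) hG
  have hev : ∀ z ∈ Metric.ball z₀ r, ∀ k : ℂ,
      (fun t : ℝ => G (z + t * k)) =ᶠ[𝓝 0] fun t : ℝ => F (z + t * k) := by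
    intro z hz k
    have hc : Tendsto (fun t : ℝ => z + t * k) (𝓝 0) (𝓝 z) :=
      (by fun_prop : Continuous fun t : ℝ => z + t * k).tendsto' _ _ (by simp)
    filter_upwards [hc.eventually (Metric.isOpen_ball.mem_nhds hz)] with t ht
    exact hGF _ (Metric.ball_subset_closedBall ht)
  have hG' : DifferentiableOn ℂ G (Metric.ball z₀ r) := by
    refine differentiableOn_of_continuous_of_cauchyRiemann (g := g) Metric.isOpen_ball
      G.continuous (fun z hz => ?_) (fun z hz => ?_)
    · have h1 := hev z hz 1
      simp only [mul_one] at h1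
      exact (hd₁ z (hball (Metric.ball_subset_closedBall hz))).congr_of_eventuallyEq h1
    · exact (hd₂ z (hball (Metric.ball_subset_closedBall hz))).congr_of_eventuallyEq
        (hev z hz Complex.I)
  have hnhds := Metric.ball_mem_nhds z₀ hr
  refine ((hG'.differentiableAt hnhds).congr_of_eventuallyEq ?_).differentiableWithinAt
  filter_upwards [hnhds] with z hz
  exact (hGF z (Metric.ball_subset_closedBall hz)).symm

/-! ### Factoring through a linear map to the plane -/

theorem hasDerivAt_zero_of_tendsto_right_left {f : ℝ → ℂ} {f' : ℂ}
    (hr : Tendsto (fun t : ℝ => t⁻¹ • (f t - f 0)) (𝓝[>] 0) (𝓝 f'))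
    (hl : Tendsto (fun t : ℝ => t⁻¹ • (f (-t) - f 0)) (𝓝[>] 0) (𝓝 (-f'))) :
    HasDerivAt f f' 0 := by
  rw [hasDerivAt_iff_tendsto_slope_zero, ← Set.Iio_union_Ioi, nhdsWithin_union]
  simp only [zero_add]
  refine Tendsto.sup ?_ hr
  have hneg : Tendsto (fun t : ℝ => -t) (𝓝[<] 0) (𝓝[>] 0) := by
    simpa using tendsto_neg_nhdsLT (a := (0 : ℝ))
  have := (hl.comp hneg).neg
  rw [neg_neg] at this
  refine this.congr fun t => ?_
  simp [inv_neg]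

/-- A continuous function on an open set `Ω` whose Gateaux derivatives are complex multiples of a
surjective real linear map `ξ` to the plane, factors through `ξ` as a holomorphic function, provided
that the intersections of `Ω` with the fibres of `ξ` are convex. -/
theorem exists_analyticOnNhd_comp {X : Type*} [NormedAddCommGroup X] [NormedSpace ℝ X]
    [CompleteSpace X] (ξ : X →L[ℝ] ℂ) (hξ : Function.Surjective ξ) {Ω : Set X} (hΩ : IsOpen Ω)
    (hconv : ∀ p ∈ Ω, ∀ q ∈ Ω, ξ p = ξ q → segment ℝ p q ⊆ Ω) {u : X → ℂ}
    (hu : ContinuousOn u Ω)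
    (hd : ∀ p ∈ Ω, ∃ c : ℂ, ∀ h : X,
      Tendsto (fun ε : ℝ => ε⁻¹ • (u (p + ε • h) - u p)) (𝓝[>] 0) (𝓝 (ξ h * c))) :
    ∃ F : ℂ → ℂ, AnalyticOnNhd ℂ F (ξ '' Ω) ∧ ∀ p ∈ Ω, u p = F (ξ p) := by
  choose! c hc using hd
  have hder : ∀ p ∈ Ω, ∀ h, HasDerivAt (fun t : ℝ => u (p + t • h)) (ξ h * c p) 0 := by
    intro p hp h
    refine hasDerivAt_zero_of_tendsto_right_left ?_ ?_
    · simpa using hc p hp h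
    · simpa using hc p hp (-h)
  -- The segment from `p` to `q` stays in `Ω`, and along it the derivative is a multiple of `ξ (q -
  -- p) = 0`.
  have hconst : ∀ p ∈ Ω, ∀ q ∈ Ω, ξ p = ξ q → u p = u q := by
    intro p hp q hq hpq
    have hseg : ∀ t ∈ Set.Icc (0 : ℝ) 1, p + t • (q - p) ∈ Ω := fun t ht =>
      hconv p hp q hq hpq (by rw [segment_eq_image']; exact ⟨t, ht, rfl⟩)
    have h := constant_of_has_deriv_right_zero (f := fun t : ℝ => u (p + t • (q - p)))
      (a := 0) (b := 1) (hu.comp (by fun_prop) hseg) (fun t ht => ?_) 1 (by simp)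
    · simpa using h.symm
    · have h0 := hder _ (hseg t ⟨ht.1, ht.2.le⟩) (q - p)
      rw [map_sub, hpq, sub_self, zero_mul] at h0
      have h1 := HasDerivAt.comp_sub_const
        (f := fun s : ℝ => u (p + t • (q - p) + s • (q - p))) t t (by rwa [sub_self])
      refine (h1.congr_of_eventuallyEq (Eventually.of_forall fun s => ?_)).hasDerivWithinAt
      simp only [add_assoc, ← add_smul, add_sub_cancel]
  have hsel : ∀ w ∈ ξ '' Ω, Function.invFunOn ξ Ω w ∈ Ω ∧ ξ (Function.invFunOn ξ Ω w) = w :=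
    fun w hw => ⟨Function.invFunOn_mem hw, Function.invFunOn_eq hw⟩
  set F : ℂ → ℂ := fun w => u (Function.invFunOn ξ Ω w) with hF
  have hFu : ∀ p ∈ Ω, u p = F (ξ p) := fun p hp => by
    have := hsel _ (Set.mem_image_of_mem ξ hp)
    exact hconst p hp _ this.1 this.2.symm
  have hopen : IsOpen (ξ '' Ω) := ξ.isOpenMap hξ _ hΩ
  have hFc : ContinuousOn F (ξ '' Ω) := by
    rintro _ ⟨p, hp, rfl⟩
    refine ContinuousAt.continuousWithinAt ?_
    have hnh := hΩ.mem_nhds hp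
    -- As `ξ` is open, neighbourhoods of `ξ p` are images of neighbourhoods of `p`, so continuity
    -- descends from `u` to `F`.
    rw [ContinuousAt, ← (ξ.isOpenMap hξ).map_nhds_eq ξ.continuous.continuousAt, tendsto_map'_iff,
      ← hFu p hp]
    refine (hu.continuousAt hnh).tendsto.congr' ?_
    filter_upwards [hnh] with q hq
    exact hFu q hq
  have hFd : ∀ w ∈ ξ '' Ω, ∀ k : ℂ, HasDerivAt (fun t : ℝ => F (w + t * k))
      (k * c (Function.invFunOn ξ Ω w)) 0 := by
    intro w hw k
    obtain ⟨hp, hpw⟩ := hsel w hw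
    set p := Function.invFunOn ξ Ω w
    -- Every direction `k` in the plane lifts to a direction `h`, along which `u` and `F` have the
    -- same increments.
    obtain ⟨h, rfl⟩ := hξ k
    refine (hder p hp h).congr_of_eventuallyEq ?_
    have hcont : Tendsto (fun t : ℝ => p + t • h) (𝓝 0) (𝓝 p) :=
      (by fun_prop : Continuous fun t : ℝ => p + t • h).tendsto' _ _ (by simp)
    filter_upwards [hcont.eventually (hΩ.mem_nhds hp)] with t ht
    rw [hFu _ ht, map_add, map_smul, hpw, Complex.real_smul]
  refine ⟨F, DifferentiableOn.analyticOnNhd ?_ hopen, hFu⟩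
  exact differentiableOn_of_continuousOn_of_cauchyRiemann
    (g := fun w => c (Function.invFunOn ξ Ω w)) hopen hFc
    (fun w hw => by simpa using hFd w hw 1) (fun w hw => hFd w hw Complex.I)

/-! ### Coordinates of complex quaternions -/

namespace ComplexQuaternion

theorem continuous_coordEquiv_apply (k : Fin 4) : Continuous fun a : HC => coordEquiv a k := by
  have h : ∀ a : HC, ‖coordEquiv a k‖ ≤ 1 * ‖a‖ := fun a => by
    rw [one_mul]
    exact PiLp.norm_apply_le (WithLp.toLp 2 (coordEquiv a)) k
  exact AddMonoidHomClass.continuous_of_bound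
    (((LinearMap.proj k : (Fin 4 → ℂ) →ₗ[ℂ] ℂ) ∘ₗ coordEquiv.toLinearMap).toAddMonoidHom) 1 h

theorem continuous_of_continuous_coordEquiv {X : Type*} [TopologicalSpace X] {f : X → HC}
    (hf : ∀ k, Continuous fun x => coordEquiv (f x) k) : Continuous f :=
  continuous_induced_rng.2 ((PiLp.continuous_toLp 2 _).comp (continuous_pi hf))

theorem coordEquiv_real_smul (r : ℝ) (a : HC) (k : Fin 4) :
    coordEquiv (r • a) k = r • coordEquiv a k := by
  fin_cases k <;> simp [coordEquiv, mul_sub]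

theorem zeta_eq (a₁ a₂ b₁ b₂ : ℂ) (p : EuclideanSpace ℝ (Fin 3)) :
    zeta a₁ a₂ b₁ b₂ p = xi₂ a₁ b₁ p • e₁ + xi₂ a₂ b₂ p • e₂ := by
  ext <;> simp [zeta, triple, xi₂, Fin.sum_univ_three, e₁, e₂] <;> ring

theorem coordEquiv_zeta (a₁ a₂ b₁ b₂ : ℂ) (p : EuclideanSpace ℝ (Fin 3)) :
    coordEquiv (zeta a₁ a₂ b₁ b₂ p) = ![xi₂ a₁ b₁ p, xi₂ a₂ b₂ p, 0, 0] := by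
  have h : zeta a₁ a₂ b₁ b₂ p = coordEquiv.symm ![xi₂ a₁ b₁ p, xi₂ a₂ b₂ p, 0, 0] := by
    rw [zeta_eq]
    simp [coordEquiv]
  rw [h, LinearEquiv.apply_symm_apply]

theorem f₂_eq (a : HC) : f₂ a = coordEquiv a 1 + coordEquiv a 3 := by
  simp [f₂, Module.Basis.constr_apply_fintype, Fin.sum_univ_four, eBasis]

theorem f₂_zeta (a₁ a₂ b₁ b₂ : ℂ) (p : EuclideanSpace ℝ (Fin 3)) :
    f₂ (zeta a₁ a₂ b₁ b₂ p) = xi₂ a₂ b₂ p := by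
  simp [f₂_eq, coordEquiv_zeta]

theorem f₂_image_Omegaζ (a₁ a₂ b₁ b₂ : ℂ) (Ω : Set (EuclideanSpace ℝ (Fin 3))) :
    f₂ '' Omegaζ a₁ a₂ b₁ b₂ Ω = xi₂ a₂ b₂ '' Ω := by
  rw [Omegaζ, Set.image_image]
  simp only [f₂_zeta]

theorem zeta_add_smul (a₁ a₂ b₁ b₂ : ℂ) (p h : EuclideanSpace ℝ (Fin 3)) (ε : ℝ) :
    zeta a₁ a₂ b₁ b₂ (p + ε • h) = zeta a₁ a₂ b₁ b₂ p + ε • zeta a₁ a₂ b₁ b₂ h := by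
  simp only [zeta, PiLp.add_apply, PiLp.smul_apply, smul_eq_mul, add_smul, mul_smul,
    Finset.sum_add_distrib, Finset.smul_sum]

theorem zeta_mem_E₃ (a₁ a₂ b₁ b₂ : ℂ) (p : EuclideanSpace ℝ (Fin 3)) :
    zeta a₁ a₂ b₁ b₂ p ∈ E₃ a₁ a₂ b₁ b₂ :=
  Submodule.sum_mem _ fun k _ =>
    Submodule.smul_mem _ _ (Submodule.subset_span (Set.mem_range_self k))

/-- `ξ₂` as a continuous real linear map. -/
noncomputable def xiCLM (a₂ b₂ : ℂ) : EuclideanSpace ℝ (Fin 3) →L[ℝ] ℂ :=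
  LinearMap.toContinuousLinearMap
    { toFun := xi₂ a₂ b₂
      map_add' := fun p q => by
        simp only [xi₂, PiLp.add_apply, Complex.ofReal_add]
        ring
      map_smul' := fun r p => by
        simp only [xi₂, PiLp.smul_apply, smul_eq_mul, Complex.ofReal_mul, RingHom.id_apply,
          Complex.real_smul]
        ring }

theorem xiCLM_apply (a₂ b₂ : ℂ) (p : EuclideanSpace ℝ (Fin 3)) : xiCLM a₂ b₂ p = xi₂ a₂ b₂ p :=
  rfl

theorem continuous_zeta (a₁ a₂ b₁ b₂ : ℂ) : Continuous (zeta a₁ a₂ b₁ b₂) := by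
  refine continuous_of_continuous_coordEquiv fun k => ?_
  simp only [coordEquiv_zeta]
  fin_cases k
  · exact (xiCLM a₁ b₁).continuous
  · exact (xiCLM a₂ b₂).continuous
  · exact continuous_const
  · exact continuous_const

theorem xiCLM_surjective {a₁ a₂ b₁ b₂ : ℂ}
    (hf₂ : f₂ '' (E₃ a₁ a₂ b₁ b₂ : Set HC) = Set.univ) :
    Function.Surjective (xiCLM a₂ b₂) := by
  intro w
  obtain ⟨e, he, rfl⟩ : w ∈ f₂ '' (E₃ a₁ a₂ b₁ b₂ : Set HC) := hf₂ ▸ Set.mem_univ w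
  obtain ⟨c, rfl⟩ := (Submodule.mem_span_range_iff_exists_fun ℝ).1 he
  exact ⟨WithLp.toLp 2 c, (f₂_zeta a₁ a₂ b₁ b₂ (WithLp.toLp 2 c)).symm⟩

theorem sub_mem_L₂ {a₂ b₂ : ℂ} {p q : EuclideanSpace ℝ (Fin 3)}
    (h : xi₂ a₂ b₂ p = xi₂ a₂ b₂ q) : q - p ∈ L₂ a₂ b₂ := by
  have hre := congrArg Complex.re h
  have him := congrArg Complex.im h
  simp [xi₂] at hre him
  refine ⟨?_, ?_⟩ <;> simp only [PiLp.sub_apply] <;> linarith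

/-- A coordinate of a map on `Ω_ζ` whose Gateaux derivative in the direction `h` is a multiple of
`ξ₂ h`, is a holomorphic function of `ξ₂`. -/
theorem exists_analyticOnNhd_coord {a₁ a₂ b₁ b₂ : ℂ}
    (hf₂ : f₂ '' (E₃ a₁ a₂ b₁ b₂ : Set HC) = Set.univ)
    {Ω : Set (EuclideanSpace ℝ (Fin 3))} (hΩ : IsOpen Ω)
    (hconv : ConvexInDirection (L₂ a₂ b₂) Ω) {Φ : HC → HC}
    (hΦ : ContinuousOn Φ (Omegaζ a₁ a₂ b₁ b₂ Ω)) (m : HC → HC → HC)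
    (hd : ∀ ζ ∈ Omegaζ a₁ a₂ b₁ b₂ Ω, ∃ Φ' : HC, ∀ h ∈ E₃ a₁ a₂ b₁ b₂,
      Tendsto (fun ε : ℝ => ε⁻¹ • (Φ (ζ + ε • h) - Φ ζ)) (𝓝[>] 0) (𝓝 (m h Φ')))
    (k : Fin 4) (hm : ∀ p Φ', coordEquiv (m (zeta a₁ a₂ b₁ b₂ p) Φ') k
      = xi₂ a₂ b₂ p * coordEquiv Φ' k) :
    ∃ F : ℂ → ℂ, AnalyticOnNhd ℂ F (f₂ '' Omegaζ a₁ a₂ b₁ b₂ Ω) ∧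
      ∀ p ∈ Ω, coordEquiv (Φ (zeta a₁ a₂ b₁ b₂ p)) k = F (xi₂ a₂ b₂ p) := by
  rw [f₂_image_Omegaζ]
  refine exists_analyticOnNhd_comp (xiCLM a₂ b₂) (xiCLM_surjective hf₂) hΩ
    (fun p hp q hq h => hconv p hp q hq (sub_mem_L₂ h))
    ((continuous_coordEquiv_apply k).comp_continuousOn
      (hΦ.comp (continuous_zeta a₁ a₂ b₁ b₂).continuousOn (Set.mapsTo_image _ _)))
    fun p hp => ?_
  obtain ⟨Φ', h'⟩ := hd _ (Set.mem_image_of_mem _ hp)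
  refine ⟨coordEquiv Φ' k, fun h => ?_⟩
  have := ((continuous_coordEquiv_apply k).tendsto _).comp (h' _ (zeta_mem_E₃ a₁ a₂ b₁ b₂ h))
  rw [hm] at this
  refine this.congr fun ε => ?_
  simp only [Function.comp_apply]
  rw [coordEquiv_real_smul, map_sub, Pi.sub_apply, zeta_add_smul]

/-- Indices start at zero, so `1`, `2`, `3` stand for `e₂`, `e₃`, `e₄`. Left multiplication by `ζ`
scales `e₂`, `e₄` by `ξ₂` and `e₁`, `e₃` by `ξ₁`; right multiplication scales `e₂`, `e₃` by `ξ₂` and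
`e₁`, `e₄` by `ξ₁`. -/
theorem coordEquiv_zeta_mul_one (a₁ a₂ b₁ b₂ : ℂ) (p : EuclideanSpace ℝ (Fin 3)) (a : HC) :
    coordEquiv (zeta a₁ a₂ b₁ b₂ p * a) 1 = xi₂ a₂ b₂ p * coordEquiv a 1 := by
  rw [zeta_eq]
  simp [coordEquiv, e₁, e₂]
  ring_nf
  simp
  ring

theorem coordEquiv_zeta_mul_three (a₁ a₂ b₁ b₂ : ℂ) (p : EuclideanSpace ℝ (Fin 3)) (a : HC) :
    coordEquiv (zeta a₁ a₂ b₁ b₂ p * a) 3 = xi₂ a₂ b₂ p * coordEquiv a 3 := by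
  rw [zeta_eq]
  simp [coordEquiv, e₁, e₂]
  ring_nf
  simp
  ring

theorem coordEquiv_mul_zeta_one (a₁ a₂ b₁ b₂ : ℂ) (p : EuclideanSpace ℝ (Fin 3)) (a : HC) :
    coordEquiv (a * zeta a₁ a₂ b₁ b₂ p) 1 = xi₂ a₂ b₂ p * coordEquiv a 1 := by
  rw [zeta_eq]
  simp [coordEquiv, e₁, e₂]
  ring_nf
  simp
  ring

theorem coordEquiv_mul_zeta_two (a₁ a₂ b₁ b₂ : ℂ) (p : EuclideanSpace ℝ (Fin 3)) (a : HC) :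
    coordEquiv (a * zeta a₁ a₂ b₁ b₂ p) 2 = xi₂ a₂ b₂ p * coordEquiv a 2 := by
  rw [zeta_eq]
  simp [coordEquiv, e₁, e₂]
  ring_nf
  simp
  ring

theorem eq_of_mem_idealI₁ {a : HC} (ha : a ∈ idealI₁) :
    a = coordEquiv a 1 • e₂ + coordEquiv a 3 • e₄ := by
  obtain ⟨l₂, l₄, rfl⟩ := ha
  have h : l₂ • e₂ + l₄ • e₄ = coordEquiv.symm ![0, l₂, 0, l₄] := by simp [coordEquiv]
  rw [h, LinearEquiv.apply_symm_apply, ← h]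
  rfl

theorem eq_of_mem_idealIhat₁ {a : HC} (ha : a ∈ idealIhat₁) :
    a = coordEquiv a 1 • e₂ + coordEquiv a 2 • e₃ := by
  obtain ⟨l₂, l₃, rfl⟩ := ha
  have h : l₂ • e₂ + l₃ • e₃ = coordEquiv.symm ![0, l₂, l₃, 0] := by simp [coordEquiv]
  rw [h, LinearEquiv.apply_symm_apply, ← h]
  rfl

end ComplexQuaternion

open ComplexQuaternion in
theorem mainTheorem6 (a₁ a₂ b₁ b₂ : ℂ)
    (hind : LinearIndependent ℝ (triple a₁ a₂ b₁ b₂))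
    (hf₁ : f₁ '' (E₃ a₁ a₂ b₁ b₂ : Set HC) = Set.univ)
    (hf₂ : f₂ '' (E₃ a₁ a₂ b₁ b₂ : Set HC) = Set.univ)
    (Ω : Set (EuclideanSpace ℝ (Fin 3))) (hΩo : IsOpen Ω) (hΩc : IsConnected Ω)
    (hconv : ConvexInDirection (L₂ a₂ b₂) Ω) :
    (∀ Φ : HC → HC,
      IsRightGMonogenic (E₃ a₁ a₂ b₁ b₂) (Omegaζ a₁ a₂ b₁ b₂ Ω) Φ →
      (∀ ζ ∈ Omegaζ a₁ a₂ b₁ b₂ Ω, Φ ζ ∈ idealI₁) →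
      ∃ F₁₂ F₁₄ : ℂ → ℂ,
        AnalyticOnNhd ℂ F₁₂ (f₂ '' Omegaζ a₁ a₂ b₁ b₂ Ω) ∧
        AnalyticOnNhd ℂ F₁₄ (f₂ '' Omegaζ a₁ a₂ b₁ b₂ Ω) ∧
        ∀ p ∈ Ω, Φ (zeta a₁ a₂ b₁ b₂ p) =
          F₁₂ (xi₂ a₂ b₂ p) • e₂ + F₁₄ (xi₂ a₂ b₂ p) • e₄) ∧
    (∀ Φ : HC → HC,
      IsLeftGMonogenic (E₃ a₁ a₂ b₁ b₂) (Omegaζ a₁ a₂ b₁ b₂ Ω) Φ →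
      (∀ ζ ∈ Omegaζ a₁ a₂ b₁ b₂ Ω, Φ ζ ∈ idealIhat₁) →
      ∃ F₁₁ F₁₃ : ℂ → ℂ,
        AnalyticOnNhd ℂ F₁₁ (f₂ '' Omegaζ a₁ a₂ b₁ b₂ Ω) ∧
        AnalyticOnNhd ℂ F₁₃ (f₂ '' Omegaζ a₁ a₂ b₁ b₂ Ω) ∧
        ∀ p ∈ Ω, Φ (zeta a₁ a₂ b₁ b₂ p) =
          F₁₁ (xi₂ a₂ b₂ p) • e₂ + F₁₃ (xi₂ a₂ b₂ p) • e₃) := by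
  refine ⟨fun Φ hΦ hI => ?_, fun Φ hΦ hI => ?_⟩
  · obtain ⟨F, hF, hF'⟩ := exists_analyticOnNhd_coord hf₂ hΩo hconv hΦ.1 (fun h a => h * a) hΦ.2 1
      (coordEquiv_zeta_mul_one a₁ a₂ b₁ b₂)
    obtain ⟨G, hG, hG'⟩ := exists_analyticOnNhd_coord hf₂ hΩo hconv hΦ.1 (fun h a => h * a) hΦ.2 3
      (coordEquiv_zeta_mul_three a₁ a₂ b₁ b₂)
    refine ⟨F, G, hF, hG, fun p hp => ?_⟩
    rw [← hF' p hp, ← hG' p hp]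
    exact eq_of_mem_idealI₁ (hI _ (Set.mem_image_of_mem _ hp))
  · obtain ⟨F, hF, hF'⟩ := exists_analyticOnNhd_coord hf₂ hΩo hconv hΦ.1 (fun h a => a * h) hΦ.2 1
      (coordEquiv_mul_zeta_one a₁ a₂ b₁ b₂)
    obtain ⟨G, hG, hG'⟩ := exists_analyticOnNhd_coord hf₂ hΩo hconv hΦ.1 (fun h a => a * h) hΦ.2 2
      (coordEquiv_mul_zeta_two a₁ a₂ b₁ b₂)
    refine ⟨F, G, hF, hG, fun p hp => ?_⟩
    rw [← hF' p hp, ← hG' p hp]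
    exact eq_of_mem_idealIhat₁ (hI _ (Set.mem_image_of_mem _ hp))
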